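/- Let $n\ge 1$, $0<\lambda\le\Lambda$, and let $$Lw(x)=\int_{\mathbb{R}^n}\Big(\frac{w(x+y)+w(x-y)}{2}-w(x)\Big)\frac{a(y)}{|y|^{n+1}}\,dy,$$ where $a\in L^\infty(\mathbb{R}^n)$ satisfies $a(y)=a(-y)$ and $\lambda\le a\le\Lambda$ almost everywhere. Let $b\in\mathbb{R}^n$, $\varepsilon>0$, $K\in\mathbb{R}$, and let $u:\mathbb{R}^n\to\mathbb{R}$ be a (globally) Lipschitz function with $u(0)=0$ such that - $u\ge 0$ in $\mathbb{R}^n$; - $\partial_{ee}u\ge -K$ in $B_2$ for all unit vectors $e$, i.e. $u+\frac K2|x|^2$ is convex in $B_2$; - for every $h\in\mathbb{R}^n$, $(-L+b\cdot\nabla)\big(u-u(\cdot-h)\big)\le K|h|$ in $\{u>0\}\cap B_2$ in the viscosity sense; - $|\nabla u(x)|\le K(1+|x|^{1-\varepsilon})$ for almost every $x\in\mathbb{R}^n$. Here $(-L+b\cdot\nabla)v\le f$ in $\Omega$ in the viscosity sense means: whenever $x_0\in\Omega$, $r>0$, and $\varphi\in C^2(\mathbb{R}^n)$ satisfies $\varphi(x_0)=v(x_0)$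 and $\varphi\ge v$ in $B_r(x_0)$, the function $w$ equal to $\varphi$ in $B_r(x_0)$ and to $v$ elsewhere satisfies $(-L+b\cdot\nabla)w(x_0)\le f$. Then $u\in C^{1,\tau}(B_{1/2})$ and $$\|u\|_{C^{1,\tau}(B_{1/2})}=\sup_{B_{1/2}}|u|+\sup_{B_{1/2}}|\nabla u|+\sup_{x\ne y\in B_{1/2}}\frac{|\nabla u(x)-\nabla u(y)|}{|x-y|^\tau}\le CK,$$ where $\tau\in(0,1)$ and $C>0$ depend only on $n$, $\|b\|$, $\varepsilon$, $\lambda$ and $\Lambda$. -/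

import Mathlib

open MeasureTheory
open scoped NNReal ENNReal

noncomputable section

/-- Euclidean space `ℝⁿ`, with the Euclidean norm and Lebesgue measure. -/
abbrev Rn (n : ℕ) : Type := EuclideanSpace ℝ (Fin n)

/-- `a ∈ L^∞(ℝⁿ)` is even and satisfies `lam ≤ a ≤ Lam` (almost everywhere, as usual in `L^∞`). -/
structure IsEllipticKernel {n : ℕ} (lam Lam : ℝ) (a : Rn n → ℝ) : Prop where
  aestronglyMeasurable : AEStronglyMeasurable a volume
  even : ∀ᵐ y : Rn n, a y = a (-y)
  lower : ∀ᵐ y : Rn n, lam ≤ a y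
  upper : ∀ᵐ y : Rn n, a y ≤ Lam

/-- The nonlocal operator of order one
`L w (x) = ∫ ((w (x + y) + w (x - y)) / 2 - w x) * a y / |y| ^ (n + 1) dy`. -/
def nonlocalOp {n : ℕ} (a : Rn n → ℝ) (w : Rn n → ℝ) (x : Rn n) : ℝ :=
  ∫ y : Rn n, ((w (x + y) + w (x - y)) / 2 - w x) * (a y / ‖y‖ ^ (n + 1))

/-- The operator with drift, `(-L + b · ∇) w (x)`. -/
def driftOp {n : ℕ} (a : Rn n → ℝ) (b : Rn n) (w : Rn n → ℝ) (x : Rn n) : ℝ :=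
  -nonlocalOp a w x + fderiv ℝ w x b

/-- The function equal to `φ` in the ball `B_r(x₀)` and to `v` outside it. -/
def glue {n : ℕ} (φ v : Rn n → ℝ) (x₀ : Rn n) (r : ℝ) (x : Rn n) : ℝ :=
  if dist x x₀ < r then φ x else v x

/-- `(-L + b · ∇) v ≤ f` in `Ω` in the viscosity sense, for a function `v` that is continuous and
bounded on `ℝⁿ`: whenever a `C²` function `φ` touches `v` from above at `x₀ ∈ Ω` in a ball
`B_r(x₀)`, the function `w` equal to `φ` in that ball and to `v` outside of it satisfies
`(-L + b · ∇) w (x₀) ≤ f`. The integral defining `L w (x₀)` then converges absolutely: `w` is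
bounded, and it is `C²` near `x₀`. -/
def ViscositySubsolution {n : ℕ} (a : Rn n → ℝ) (b : Rn n) (Ω : Set (Rn n)) (f : ℝ)
    (v : Rn n → ℝ) : Prop :=
  ∀ x₀ ∈ Ω, ∀ r : ℝ, 0 < r → ∀ φ : Rn n → ℝ, ContDiff ℝ 2 φ →
    φ x₀ = v x₀ → (∀ x, dist x x₀ < r → v x ≤ φ x) →
    driftOp a b (glue φ v x₀ r) x₀ ≤ f

/-- `∂_{ee} u ≥ -K` in the convex set `U` for every unit vector `e` (semiconvexity): the function
`u + (K / 2) |x|²` is convex in `U`. -/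
def SemiconvexOn {n : ℕ} (K : ℝ) (U : Set (Rn n)) (u : Rn n → ℝ) : Prop :=
  ConvexOn ℝ U (fun x => u x + K / 2 * ‖x‖ ^ 2)

/-- The norm `sup_U |u| + sup_U |∇u| + [∇u]_{C^τ(U)}` of a function that is `C¹` in the open
set `U`, as an extended nonnegative number. -/
def eC1HolderNorm {n : ℕ} (τ : ℝ≥0) (U : Set (Rn n)) (u : Rn n → ℝ) : ℝ≥0∞ :=
  (⨆ x ∈ U, ‖u x‖ₑ) + (⨆ x ∈ U, ‖fderiv ℝ u x‖ₑ) + eHolderNorm τ (U.domRestrict (fderiv ℝ u))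

end

noncomputable section Auxiliary

open Filter Topology Metric Set

/-! The nonlocal part and the drift both have order one, so zooming in changes neither the
ellipticity constants nor `b`, and a gain at one scale can be iterated.

The gain is `exists_lipOnBall_improvement`. Let `w` be almost convex and almost nonnegative, with `w
0 = 0`, Lipschitz constant about 1 in the unit ball and slow growth outside. If an increment `v = w
- w (· - h)` nearly reached `‖h‖` near the origin, a flat paraboloid would touch `v` from above at a
nearby point. But around `-h/‖h‖` the slope of `w` in direction `h` is at most its slope towards
points near the origin, where `w` is small, so `v ≤ ‖h‖/2` on a ball of fixed size. The operator
sees this deficit, while paraboloid, tail and drift cost only multiples of `μ‖h‖`. For small `μ` the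
subsolution inequality fails. Iteration over the scales `8⁻ᵏ` gives `exists_holder_decay`.

For `u` there are two ways to use the decay. At a zero of `u` the zero slope is supporting, and a
positive increment forces `u > 0`, where the inequality is known. At distance `d > 0` from the zero
set, the ball of radius `d` lies in `{u > 0}`, so the tangent plane can be subtracted: scales below
`d` come from the decay there, larger ones from the nearest zero. Hence `u - ℓ` has Lipschitz
constant of order `K ρ ^ τ` in balls of radius `ρ`, uniformly in the centre, which is the `C^{1,τ}`
bound. -/

/-! ### Lipschitz bounds from almost everywhere gradient bounds -/

/-- By Fubini, almost every translate of the segment from `x` to `y` meets the bad null set in a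
null set of parameters, and there the fundamental theorem of calculus applies. A violation of the
bound is an open condition on the translate, so one good translate would violate it too. -/
theorem LipschitzWith.abs_sub_le_of_ae_norm_fderiv_le {n : ℕ} {u : Rn n → ℝ} {L : ℝ≥0}
    (hu : LipschitzWith L u) {U : Set (Rn n)} (hU : IsOpen U) (hUc : Convex ℝ U) {M : ℝ}
    (hM : ∀ᵐ x : Rn n, x ∈ U → ‖fderiv ℝ u x‖ ≤ M) {x y : Rn n} (hx : x ∈ U) (hy : y ∈ U) :
    |u y - u x| ≤ M * ‖y - x‖ := by
  set v := y - x with hv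
  have hae : ∀ᵐ z : Rn n, DifferentiableAt ℝ u z ∧ (z ∈ U → ‖fderiv ℝ u z‖ ≤ M) := by
    filter_upwards [hM, hu.ae_differentiableAt] with z h1 h2 using ⟨h2, h1⟩
  set N := toMeasurable volume {z : Rn n | ¬ (DifferentiableAt ℝ u z ∧
    (z ∈ U → ‖fderiv ℝ u z‖ ≤ M))} with hN
  have hN0 : volume N = 0 := by rw [hN, measure_toMeasurable]; exact hae
  have hNm : MeasurableSet N := measurableSet_toMeasurable _ _
  have hlines : ∀ᵐ z : Rn n, ∀ᵐ t : ℝ, z + t • v ∉ N := by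
    have hmeas : MeasurableSet {q : Rn n × ℝ | q.1 + q.2 • v ∉ N} := by
      have : Measurable (fun q : Rn n × ℝ => q.1 + q.2 • v) := by fun_prop
      exact this hNm.compl
    rw [Measure.ae_ae_comm (p := fun (z : Rn n) (t : ℝ) => z + t • v ∉ N) hmeas]
    refine Eventually.of_forall fun t => ?_
    have h1 : ∀ᵐ z : Rn n, z ∉ N := measure_eq_zero_iff_ae_notMem.1 hN0
    exact (measurePreserving_add_right volume (t • v)).quasiMeasurePreserving.ae h1
  by_contra! hcon
  have hopen : IsOpen {z : Rn n | z ∈ U ∧ z + v ∈ U ∧ M * ‖v‖ < |u (z + v) - u z|} := by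
    have hc := hu.continuous
    refine hU.inter ((hU.preimage (continuous_id.add continuous_const)).inter ?_)
    exact isOpen_lt continuous_const
      ((hc.comp (continuous_id.add continuous_const)).sub hc).abs
  have hxin : x ∈ {z : Rn n | z ∈ U ∧ z + v ∈ U ∧ M * ‖v‖ < |u (z + v) - u z|} := by
    have : x + v = y := by rw [hv]; abel
    simp only [mem_ofPred_eq, this]
    exact ⟨hx, hy, hcon⟩
  obtain ⟨z, ⟨hz1, hz2, hz3⟩, hz4⟩ :=
    (Measure.dense_of_ae hlines).inter_open_nonempty _ hopen ⟨x, hxin⟩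
  have hlip : LipschitzWith (L * ‖v‖₊) (fun t : ℝ => u (z + t • v)) := by
    refine hu.comp (LipschitzWith.of_dist_le_mul fun s t => ?_)
    rw [dist_add_left, dist_eq_norm, ← sub_smul, norm_smul, dist_eq_norm, mul_comm]
    rfl
  have hftc := (hlip.lipschitzOnWith (s := uIcc (0 : ℝ) 1)).absolutelyContinuousOnInterval
    |>.integral_deriv_eq_sub
  have hb : ‖∫ t in (0 : ℝ)..1, deriv (fun t : ℝ => u (z + t • v)) t‖ ≤
      (M * ‖v‖) * |1 - 0| := by
    refine intervalIntegral.norm_integral_le_of_norm_le_const_ae ?_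
    filter_upwards [hz4] with t ht htI
    have ht' : DifferentiableAt ℝ u (z + t • v) ∧
        (z + t • v ∈ U → ‖fderiv ℝ u (z + t • v)‖ ≤ M) := by
      by_contra hcc
      exact ht (subset_toMeasurable _ _ hcc)
    rw [uIoc_of_le zero_le_one] at htI
    have hmem : z + t • v ∈ U := by
      have := hUc.add_smul_sub_mem hz1 hz2 ⟨htI.1.le, htI.2⟩
      simpa using this
    have hd : HasDerivAt (fun t : ℝ => u (z + t • v)) (fderiv ℝ u (z + t • v) v) t := by
      have h1 : HasDerivAt (fun t : ℝ => z + t • v) v t := by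
        simpa using ((hasDerivAt_id t).smul_const v).const_add z
      exact ht'.1.hasFDerivAt.comp_hasDerivAt t h1
    rw [hd.deriv]
    exact (ContinuousLinearMap.le_opNorm _ _).trans
      (mul_le_mul_of_nonneg_right (ht'.2 hmem) (norm_nonneg _))
  rw [hftc] at hb
  simp only [one_smul, zero_smul, add_zero, sub_zero, abs_one, mul_one, Real.norm_eq_abs] at hb
  linarith

/-! ### Scaling of the operator, of the kernel and of viscosity inequalities -/

/-- Substitute `r • y` for `y`: the Jacobian `r ^ n` against the homogeneity `-(n + 1)` of the
kernel leaves one power of `r`. -/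
theorem nonlocalOp_comp_affine {n : ℕ} (a v : Rn n → ℝ) (x₀ x : Rn n) {r : ℝ} (hr : 0 < r)
    (A c : ℝ) :
    nonlocalOp (fun y => a (r • y)) (fun y => A * (v (x₀ + r • y) - c)) x =
      A * r * nonlocalOp a v (x₀ + r • x) := by
  unfold nonlocalOp
  have key := Measure.integral_comp_smul (volume : Measure (Rn n))
    (fun y => ((v (x₀ + r • x + y) + v (x₀ + r • x - y)) / 2 - v (x₀ + r • x)) *
      (a y / ‖y‖ ^ (n + 1))) r
  simp only [finrank_euclideanSpace, Fintype.card_fin, smul_eq_mul] at key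
  rw [abs_of_pos (by positivity)] at key
  have hrn : r ^ n ≠ 0 := by positivity
  have key' : ∫ y, ((v (x₀ + r • x + y) + v (x₀ + r • x - y)) / 2 - v (x₀ + r • x)) *
      (a y / ‖y‖ ^ (n + 1)) = r ^ n * ∫ y, ((v (x₀ + r • x + r • y) + v (x₀ + r • x - r • y)) / 2 -
        v (x₀ + r • x)) * (a (r • y) / ‖r • y‖ ^ (n + 1)) := by
    rw [key, ← mul_assoc, mul_inv_cancel₀ hrn, one_mul]
  rw [key', ← mul_assoc, ← integral_const_mul]
  congr 1
  funext y
  beta_reduce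
  rw [norm_smul, Real.norm_of_nonneg hr.le, mul_pow, smul_add, smul_sub, ← add_assoc,
    ← add_sub_assoc]
  rcases eq_or_ne ‖y‖ 0 with hy | hy
  · simp [hy]
  · field_simp
    ring

/-- The gradient gains the same factor `A * r` as the nonlocal part, so `b` is the same at every
scale. -/
theorem driftOp_comp_affine {n : ℕ} (a v : Rn n → ℝ) (b x₀ x : Rn n) {r : ℝ} (hr : 0 < r)
    {A : ℝ} (hA : 0 < A) (c : ℝ) :
    driftOp (fun y => a (r • y)) b (fun y => A * (v (x₀ + r • y) - c)) x =
      A * r * driftOp a b v (x₀ + r • x) := by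
  unfold driftOp
  rw [nonlocalOp_comp_affine a v x₀ x hr A c]
  have h1 : fderiv ℝ (fun y => A * (v (x₀ + r • y) - c)) x
      = A • (r • fderiv ℝ v (x₀ + r • x)) := by
    have : Invertible A := invertibleOfNonzero hA.ne'
    have e : (fun y => A * (v (x₀ + r • y) - c)) =
        A • (fun y => (fun z => v (x₀ + z) - c) (r • y)) := by
      funext y; simp
    rw [e, fderiv_const_smul_of_invertible, fderiv_comp_smul (f := fun z => v (x₀ + z) - c)]
    simp only [fderiv_sub_const]
    rw [fderiv_comp_add_left]
  rw [h1]
  simp only [smul_apply, smul_eq_mul]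
  ring

theorem ViscositySubsolution.mono {n : ℕ} {a : Rn n → ℝ} {b : Rn n} {Ω Ω' : Set (Rn n)} {f f' : ℝ}
    {v : Rn n → ℝ} (hv : ViscositySubsolution a b Ω f v) (hΩ : Ω' ⊆ Ω) (hf : f ≤ f') :
    ViscositySubsolution a b Ω' f' v :=
  fun x₀ hx₀ r hr φ hφ h1 h2 => (hv x₀ (hΩ hx₀) r hr φ hφ h1 h2).trans hf

theorem ViscositySubsolution.comp_affine {n : ℕ} {a : Rn n → ℝ} {b : Rn n} {Ω : Set (Rn n)} {f : ℝ}
    {v : Rn n → ℝ} (hv : ViscositySubsolution a b Ω f v) (x₀ : Rn n) {r : ℝ} (hr : 0 < r)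
    {A : ℝ} (hA : 0 < A) (c : ℝ) :
    ViscositySubsolution (fun y => a (r • y)) b {x | x₀ + r • x ∈ Ω} (A * r * f)
      (fun x => A * (v (x₀ + r • x) - c)) := by
  intro x₁ hx₁ ρ hρ φ hφ h1 h2
  set ψ : Rn n → ℝ := fun z => A⁻¹ * φ (r⁻¹ • (z - x₀)) + c with hψ
  have hrr : ∀ x : Rn n, r⁻¹ • (x₀ + r • x - x₀) = x := fun x => by
    rw [add_sub_cancel_left, smul_smul, inv_mul_cancel₀ hr.ne', one_smul]
  have hrr' : ∀ z : Rn n, x₀ + r • (r⁻¹ • (z - x₀)) = z := fun z => by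
    rw [smul_smul, mul_inv_cancel₀ hr.ne', one_smul]; abel
  have hdist : ∀ x : Rn n, dist (x₀ + r • x) (x₀ + r • x₁) = r * dist x x₁ := fun x => by
    rw [dist_add_left, dist_smul₀, Real.norm_of_nonneg hr.le]
  have hψx : ∀ x : Rn n, ψ (x₀ + r • x) = A⁻¹ * φ x + c := fun x => by
    simp only [hψ, hrr]
  have hAA : ∀ s : ℝ, A * (A⁻¹ * s + c - c) = s := fun s => by
    field_simp; ring
  have hglue : glue φ (fun x => A * (v (x₀ + r • x) - c)) x₁ ρ =
      fun x => A * (glue ψ v (x₀ + r • x₁) (r * ρ) (x₀ + r • x) - c) := by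
    funext x
    unfold glue
    rw [hdist]
    by_cases h : dist x x₁ < ρ
    · rw [if_pos h, if_pos (mul_lt_mul_of_pos_left h hr), hψx, hAA]
    · rw [if_neg h, if_neg (fun h' => h (lt_of_mul_lt_mul_left h' hr.le))]
  rw [hglue, driftOp_comp_affine a _ b x₀ x₁ hr hA c]
  refine mul_le_mul_of_nonneg_left ?_ (by positivity)
  refine hv _ hx₁ (r * ρ) (by positivity) ψ ?_ ?_ ?_
  · simp only [hψ]
    fun_prop
  · rw [hψx, h1]
    field_simp; ring
  · intro z hz
    rw [← hrr' z] at hz ⊢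
    rw [hψx]
    have h3 := h2 (r⁻¹ • (z - x₀)) (lt_of_mul_lt_mul_left (hdist _ ▸ hz) hr.le)
    have h4 := mul_le_mul_of_nonneg_left h3 (inv_pos.2 hA).le
    rw [← mul_assoc, inv_mul_cancel₀ hA.ne', one_mul] at h4
    linarith

theorem IsEllipticKernel.comp_smul {n : ℕ} {lam Lam : ℝ} {a : Rn n → ℝ}
    (ha : IsEllipticKernel lam Lam a) {r : ℝ} (hr : 0 < r) :
    IsEllipticKernel lam Lam (fun y => a (r • y)) := by
  have hq : Measure.QuasiMeasurePreserving (fun y : Rn n => r • y) volume volume := by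
    refine ⟨by fun_prop, ?_⟩
    rw [Measure.map_addHaar_smul volume hr.ne']
    exact Measure.smul_absolutelyContinuous
  refine ⟨ha.1.comp_quasiMeasurePreserving hq, ?_, hq.ae ha.lower, hq.ae ha.upper⟩
  filter_upwards [hq.ae ha.even] with y hy
  rw [hy, smul_neg]

/-! ### Almost convex solutions -/

/-- The function `w` is Lipschitz with constant `c` in the ball of centre `z` and radius `r`. -/
def LipOnBall {n : ℕ} (w : Rn n → ℝ) (z : Rn n) (r c : ℝ) : Prop :=
  ∀ x ∈ ball z r, ∀ y ∈ ball z r, |w x - w y| ≤ c * ‖x - y‖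

/-- `w` vanishes at the origin, lies above a flat paraboloid with vertex there, is almost convex in
`B_2`, and its increments are subsolutions at the points of `B_2` where they are positive. -/
structure AlmostConvexSolution {n : ℕ} (a : Rn n → ℝ) (b : Rn n) (μ : ℝ) (w : Rn n → ℝ) :
    Prop where
  lipschitz : ∃ M : ℝ≥0, LipschitzWith M w
  zero : w 0 = 0
  nonneg : ∀ x ∈ ball (0 : Rn n) 2, 0 ≤ w x + μ / 2 * ‖x‖ ^ 2
  semiconvex : SemiconvexOn μ (ball 0 2) w
  subsolution : ∀ h : Rn n, ViscositySubsolution a b ({x | w (x - h) < w x} ∩ ball 0 2) (μ * ‖h‖)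
    (fun x => w x - w (x - h))

/-- Convexity and the contact with a paraboloid at the origin make the increments in the direction
`h` small behind the origin. -/
theorem AlmostConvexSolution.sub_le_half {n : ℕ} {a : Rn n → ℝ} {b : Rn n} {μ : ℝ} {w : Rn n → ℝ}
    (hw : AlmostConvexSolution a b μ w) (hμ : 0 < μ) (hμ' : μ ≤ 1 / 8)
    (hlip : LipOnBall w 0 1 (1 + μ)) {x h : Rn n} (h0 : h ≠ 0) (hh : ‖h‖ ≤ 1 / 4)
    (hx : ‖x + ‖h‖⁻¹ • h‖ < 1 / 4) : w x - w (x - h) ≤ ‖h‖ / 2 := by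
  set s := ‖h‖ with hs
  have hs0 : 0 < s := norm_pos_iff.2 h0
  set e := s⁻¹ • h with he
  have hen : ‖e‖ = 1 := by
    rw [he, norm_smul, norm_inv, Real.norm_of_nonneg hs0.le, ← hs, inv_mul_cancel₀ hs0.ne']
  have hse : s • e = h := by rw [he, smul_smul, mul_inv_cancel₀ hs0.ne', one_smul]
  have hxn : ‖x‖ ≤ 5 / 4 := by
    have : ‖x‖ ≤ ‖x + e‖ + ‖e‖ := by simpa using norm_sub_le (x + e) e
    linarith
  have hxh : ‖x - h‖ ≤ ‖x‖ + s := norm_sub_le _ _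
  have hz2 : x + e ∈ ball (0 : Rn n) 2 := by rw [mem_ball_zero_iff]; linarith
  have hx2 : x ∈ ball (0 : Rn n) 2 := by rw [mem_ball_zero_iff]; linarith
  have hxh2 : x - h ∈ ball (0 : Rn n) 2 := by rw [mem_ball_zero_iff]; linarith
  have hW : ConvexOn ℝ (ball 0 2) (fun x => w x + μ / 2 * ‖x‖ ^ 2) := hw.semiconvex
  -- The point `x` lies on the segment from `x - h` to `x + e`, so the slope behind `x` is at most
  -- the slope ahead of it. The latter is small: `x + e` is close to the origin and the function is
  -- nonnegative at `x`.
  have hconv := hW.2 hz2 hxh2 (by positivity : 0 ≤ s / (1 + s))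
    (by positivity : 0 ≤ 1 / (1 + s)) (by field_simp; ring)
  have hcomb : (s / (1 + s)) • (x + e) + (1 / (1 + s)) • (x - h) = x := by
    clear_value e
    rw [← hse]
    match_scalars <;> field_simp <;> ring
  rw [hcomb] at hconv
  simp only [smul_eq_mul] at hconv
  have hconv' : (1 + s) * (w x + μ / 2 * ‖x‖ ^ 2) ≤
      s * (w (x + e) + μ / 2 * ‖x + e‖ ^ 2) + (w (x - h) + μ / 2 * ‖x - h‖ ^ 2) := by
    have h3 := mul_le_mul_of_nonneg_left hconv (by positivity : (0 : ℝ) ≤ 1 + s)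
    refine h3.trans (le_of_eq ?_)
    field_simp
  have hWx := hw.nonneg x hx2
  have hwz : w (x + e) ≤ (1 + μ) * ‖x + e‖ := by
    have := hlip (x + e) (by rw [mem_ball_zero_iff]; linarith) 0 (by simp)
    rw [hw.zero, sub_zero, sub_zero] at this
    exact (le_abs_self _).trans this
  have hz4 : ‖x + e‖ ^ 2 ≤ 1 / 16 := by nlinarith [norm_nonneg (x + e)]
  have hWz : w (x + e) + μ / 2 * ‖x + e‖ ^ 2 ≤ 73 / 256 := by
    have h5 : (1 + μ) * ‖x + e‖ ≤ 9 / 8 * (1 / 4) :=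
      mul_le_mul (by linarith) hx.le (norm_nonneg _) (by norm_num)
    have h6 : μ / 2 * ‖x + e‖ ^ 2 ≤ 1 / 16 * (1 / 16) :=
      mul_le_mul (by linarith) hz4 (by positivity) (by norm_num)
    linarith
  have hsq : ‖x - h‖ ^ 2 - ‖x‖ ^ 2 ≤ 3 * s := by
    have h5 : ‖x - h‖ ^ 2 ≤ (‖x‖ + s) ^ 2 := pow_le_pow_left₀ (norm_nonneg _) hxh 2
    nlinarith [norm_nonneg x]
  have h6 : s * (w (x + e) + μ / 2 * ‖x + e‖ ^ 2) ≤ s * (73 / 256) :=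
    mul_le_mul_of_nonneg_left hWz hs0.le
  have h7 : 0 ≤ s * (w x + μ / 2 * ‖x‖ ^ 2) := mul_nonneg hs0.le hWx
  have h8 : μ / 2 * (‖x - h‖ ^ 2 - ‖x‖ ^ 2) ≤ 1 / 16 * (3 * s) := by
    exact (mul_le_mul_of_nonneg_left hsq (by positivity)).trans
      (mul_le_mul_of_nonneg_right (by linarith) (by positivity))
  -- The coefficients of `s` add up to `73/256 + 3/16 = 121/256 < 1/2`.
  linarith

/-! ### Upper bound for the nonlocal operator -/

/-- The radial majorant for the integrals defining the nonlocal operator. -/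
def radialMajorant (n : ℕ) (ε s : ℝ) : ℝ :=
  if s < 3 / 8 then s ^ 2 / s ^ (n + 1) else s ^ (1 - ε) / s ^ (n + 1)

theorem radialMajorant_nonneg (n : ℕ) (ε : ℝ) {s : ℝ} (hs : 0 ≤ s) : 0 ≤ radialMajorant n ε s := by
  unfold radialMajorant
  split_ifs <;> positivity

/-- In polar coordinates the weight `s ^ (n - 1)` turns the two branches into `1` and `s ^ (-1 -
ε)`. -/
theorem integrable_radialMajorant {n : ℕ} (hn : 1 ≤ n) {ε : ℝ} (hε : 0 < ε) :
    Integrable (fun y : Rn n => radialMajorant n ε ‖y‖) := by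
  have : Nonempty (Fin n) := ⟨⟨0, hn⟩⟩
  rw [integrable_fun_norm_addHaar (volume : Measure (Rn n)) (f := radialMajorant n ε)]
  simp only [finrank_euclideanSpace, Fintype.card_fin, smul_eq_mul]
  have hsplit : Ioi (0 : ℝ) = Ioo 0 (3 / 8) ∪ Ici (3 / 8) := by
    rw [Ioo_union_Ici_eq_Ioi]; norm_num
  obtain ⟨m, rfl⟩ : ∃ m, n = m + 1 := ⟨n - 1, by omega⟩
  rw [hsplit, integrableOn_union]
  constructor
  · refine IntegrableOn.congr_fun (f := fun _ => (1 : ℝ)) (integrableOn_const (by simp)) ?_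
      measurableSet_Ioo
    intro s hs
    have hs0 : s ≠ 0 := hs.1.ne'
    simp only [radialMajorant, if_pos hs.2, Nat.add_sub_cancel]
    field_simp
    ring
  · have h1 : IntegrableOn (fun s : ℝ => s ^ (-1 - ε)) (Ici (3 / 8)) := by
      rw [integrableOn_Ici_iff_integrableOn_Ioi]
      exact integrableOn_Ioi_rpow_of_lt (by linarith) (by norm_num)
    refine IntegrableOn.congr_fun h1 ?_ measurableSet_Ici
    intro s hs
    have hs0 : 0 < s := lt_of_lt_of_le (by norm_num) hs
    simp only [radialMajorant, if_neg (not_lt.2 (mem_Ici.1 hs)), Nat.add_sub_cancel]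
    have : (1 - ε) = (-1 - ε) + 2 := by ring
    rw [this, Real.rpow_add hs0]
    rw [Real.rpow_two]
    field_simp
    ring

theorem one_le_rpow_of_far {ε q : ℝ} (hε : 0 ≤ ε) (hε' : ε ≤ 1) (hq : 3 / 8 ≤ q) :
    1 ≤ 8 / 3 * q ^ (1 - ε) := by
  have h1 : 1 ≤ (8 / 3 * q) ^ (1 - ε) := Real.one_le_rpow (by linarith) (by linarith)
  rw [Real.mul_rpow (by norm_num) (by linarith)] at h1
  have h2 : (8 / 3 : ℝ) ^ (1 - ε) ≤ (8 / 3 : ℝ) ^ (1 : ℝ) :=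
    Real.rpow_le_rpow_of_exponent_le (by norm_num) (by linarith)
  rw [Real.rpow_one] at h2
  exact h1.trans (mul_le_mul_of_nonneg_right h2 (Real.rpow_nonneg (by linarith) _))

theorem add_one_rpow_le_of_far {ε q : ℝ} (hε : 0 ≤ ε) (hε' : ε ≤ 1) (hq : 3 / 8 ≤ q) :
    (q + 1) ^ (1 - ε) ≤ 4 * q ^ (1 - ε) := by
  have h1 : (q + 1) ^ (1 - ε) ≤ (4 * q) ^ (1 - ε) :=
    Real.rpow_le_rpow (by linarith) (by linarith) (by linarith)
  rw [Real.mul_rpow (by norm_num) (by linarith)] at h1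
  have h2 : (4 : ℝ) ^ (1 - ε) ≤ (4 : ℝ) ^ (1 : ℝ) :=
    Real.rpow_le_rpow_of_exponent_le (by norm_num) (by linarith)
  rw [Real.rpow_one] at h2
  exact h1.trans (mul_le_mul_of_nonneg_right h2 (Real.rpow_nonneg (by linarith) _))

/-- If the second differences of `g` at `x` are controlled by a paraboloid near `x`, have little
growth far away, and are quite negative on a ball `S`, then so is the nonlocal operator. -/
theorem nonlocalOp_le_of_secondDiff_le {n : ℕ} (hn : 1 ≤ n) {lam Lam : ℝ} (hlam : 0 < lam)
    {ε : ℝ} (hε : 0 < ε) (hε' : ε ≤ 1) {a : Rn n → ℝ} (ha : IsEllipticKernel lam Lam a)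
    {g : Rn n → ℝ} (hg : Measurable g) {x : Rn n} {κ B s : ℝ} (hs : 0 ≤ s)
    {p : Rn n} (hκ : 0 ≤ κ)
    (hnear : ∀ y : Rn n, ‖y‖ < 3 / 8 → (g (x + y) + g (x - y)) / 2 - g x = κ * ‖y‖ ^ 2)
    (hbdd : ∀ y : Rn n, 3 / 8 ≤ ‖y‖ → |(g (x + y) + g (x - y)) / 2 - g x| ≤ B)
    (hfar : ∀ y : Rn n, 3 / 8 ≤ ‖y‖ → (g (x + y) + g (x - y)) / 2 - g x ≤ κ * ‖y‖ ^ (1 - ε))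
    (hS : ∀ y ∈ ball p (1 / 4), 3 / 8 ≤ ‖y‖ ∧ ‖y‖ ≤ 2 ∧
      (g (x + y) + g (x - y)) / 2 - g x ≤ κ * ‖y‖ ^ (1 - ε) - s / 4) :
    nonlocalOp a g x ≤ κ * Lam * (∫ y : Rn n, radialMajorant n ε ‖y‖) -
      s * (lam / 2 ^ (n + 3) * (volume (ball (0 : Rn n) (1 / 4))).toReal) := by
  set D : Rn n → ℝ := fun y => (g (x + y) + g (x - y)) / 2 - g x with hD
  have hm := integrable_radialMajorant hn hε
  have hvol : volume (ball p (1 / 4)) = volume (ball (0 : Rn n) (1 / 4)) :=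
    Measure.addHaar_ball_center _ _ _
  have hball : Integrable ((ball p (1 / 4)).indicator fun _ => s * (lam / 2 ^ (n + 3))) := by
    rw [integrable_indicator_iff measurableSet_ball]
    exact integrableOn_const measure_ball_lt_top.ne
  have hB : 0 ≤ max B 0 := le_max_right _ _
  have hDm : Measurable D := by
    have h1 : Measurable fun y => g (x + y) := hg.comp (measurable_const_add x)
    have h2 : Measurable fun y => g (x - y) := hg.comp (measurable_const_sub x)
    exact ((h1.add h2).div_const 2).sub_const _
  -- Integrability needs the two-sided bound `B`, since `hfar` is one-sided; `B` does not enter the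
  -- final estimate.
  have hint : Integrable (fun y => D y * (a y / ‖y‖ ^ (n + 1))) := by
    refine (hm.const_mul ((κ + 8 / 3 * max B 0) * Lam)).mono'
      (hDm.aestronglyMeasurable.mul
        (ha.1.aemeasurable.div (measurable_norm.pow_const _).aemeasurable).aestronglyMeasurable) ?_
    filter_upwards [ha.lower, ha.upper] with y h1 h2
    have hay : |a y / ‖y‖ ^ (n + 1)| ≤ Lam / ‖y‖ ^ (n + 1) := by
      rw [abs_of_nonneg (div_nonneg (by linarith) (by positivity))]
      gcongr
    rw [Real.norm_eq_abs, abs_mul]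
    rcases lt_or_ge ‖y‖ (3 / 8) with hy | hy
    · have : |D y| ≤ (κ + 8 / 3 * max B 0) * ‖y‖ ^ 2 := by
        rw [hD]; beta_reduce
        rw [hnear y hy, abs_of_nonneg (by positivity)]
        gcongr; linarith
      refine (mul_le_mul this hay (abs_nonneg _) (by positivity)).trans (le_of_eq ?_)
      rw [radialMajorant, if_pos hy]; ring
    · have : |D y| ≤ (κ + 8 / 3 * max B 0) * ‖y‖ ^ (1 - ε) := by
        have h3 := one_le_rpow_of_far hε.le hε' hy
        have h4 : max B 0 * 1 ≤ max B 0 * (8 / 3 * ‖y‖ ^ (1 - ε)) := by gcongr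
        have h5 : 0 ≤ κ * ‖y‖ ^ (1 - ε) := by positivity
        have h6 := (hbdd y hy).trans (le_max_left B 0)
        have h7 : |D y| ≤ max B 0 := h6
        linarith
      refine (mul_le_mul this hay (abs_nonneg _) (by positivity)).trans (le_of_eq ?_)
      rw [radialMajorant, if_neg (not_lt.2 hy)]; ring
  have hle : ∀ᵐ y : Rn n, D y * (a y / ‖y‖ ^ (n + 1)) ≤ κ * Lam * radialMajorant n ε ‖y‖ -
      (ball p (1 / 4)).indicator (fun _ => s * (lam / 2 ^ (n + 3))) y := by
    filter_upwards [ha.lower, ha.upper] with y h1 h2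
    have hk0 : 0 ≤ a y / ‖y‖ ^ (n + 1) := div_nonneg (by linarith) (by positivity)
    have hay : a y / ‖y‖ ^ (n + 1) ≤ Lam / ‖y‖ ^ (n + 1) := by gcongr
    by_cases hyS : y ∈ ball p (1 / 4)
    · rw [indicator_of_mem hyS]
      obtain ⟨h3, h4, h5⟩ := hS y hyS
      have hy0 : 0 < ‖y‖ := by linarith
      have h6 := mul_le_mul_of_nonneg_right h5 hk0
      have h7 : lam / 2 ^ (n + 1) ≤ a y / ‖y‖ ^ (n + 1) :=
        div_le_div₀ (by linarith) h1 (by positivity) (by gcongr)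
      have h8 : κ * ‖y‖ ^ (1 - ε) * (a y / ‖y‖ ^ (n + 1)) ≤
          κ * ‖y‖ ^ (1 - ε) * (Lam / ‖y‖ ^ (n + 1)) := by gcongr
      have h9 : s / 4 * (lam / 2 ^ (n + 1)) ≤ s / 4 * (a y / ‖y‖ ^ (n + 1)) := by gcongr
      have h10 : s / 4 * (lam / 2 ^ (n + 1)) = s * (lam / 2 ^ (n + 3)) := by
        rw [pow_succ, pow_add]; field_simp; norm_num
      have h11 : κ * ‖y‖ ^ (1 - ε) * (Lam / ‖y‖ ^ (n + 1)) =
          κ * Lam * radialMajorant n ε ‖y‖ := by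
        rw [radialMajorant, if_neg (not_lt.2 h3)]; ring
      have h12 : D y * (a y / ‖y‖ ^ (n + 1)) ≤
        (κ * ‖y‖ ^ (1 - ε) - s / 4) * (a y / ‖y‖ ^ (n + 1)) := h6
      linarith
    · rw [indicator_of_notMem hyS, sub_zero]
      rcases lt_or_ge ‖y‖ (3 / 8) with hy | hy
      · rw [hD]; beta_reduce
        rw [hnear y hy, radialMajorant, if_pos hy]
        refine (mul_le_mul_of_nonneg_left hay (by positivity)).trans (le_of_eq (by ring))
      · refine (mul_le_mul_of_nonneg_right (hfar y hy) hk0).trans ?_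
        rw [radialMajorant, if_neg (not_lt.2 hy)]
        refine (mul_le_mul_of_nonneg_left hay (by positivity)).trans (le_of_eq (by ring))
  have hfin := integral_mono_ae hint ((hm.const_mul (κ * Lam)).sub hball) hle
  rw [integral_sub' (hm.const_mul (κ * Lam)) hball, integral_const_mul,
    integral_indicator measurableSet_ball, setIntegral_const, measureReal_def, hvol] at hfin
  refine hfin.trans (le_of_eq ?_)
  rw [smul_eq_mul]
  ring

/-! ### Improvement of the Lipschitz constant -/

set_option maxHeartbeats 1000000 in
/-- The Lipschitz constant improves in a smaller ball. -/
theorem exists_lipOnBall_improvement {n : ℕ} (hn : 1 ≤ n) {lam : ℝ} (hlam : 0 < lam) {Lam : ℝ}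
    (hLam : lam ≤ Lam) {ε : ℝ} (hε : 0 < ε) (hε' : ε ≤ 1) (β : ℝ) :
    ∃ μ : ℝ, 0 < μ ∧ μ ≤ 1 / 8 ∧ ∀ (a : Rn n → ℝ) (b : Rn n) (w : Rn n → ℝ),
      IsEllipticKernel lam Lam a → ‖b‖ = β → AlmostConvexSolution a b μ w →
      (∀ R : ℝ, 1 ≤ R → LipOnBall w 0 R (1 + μ * R ^ (1 - ε))) →
      LipOnBall w 0 (1 / 8) (1 - μ) := by
  set J := ∫ y : Rn n, radialMajorant n ε ‖y‖ with hJ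
  have hJ0 : 0 ≤ J := integral_nonneg fun y => radialMajorant_nonneg n ε (norm_nonneg y)
  set c₀ := lam / 2 ^ (n + 3) * (volume (ball (0 : Rn n) (1 / 4))).toReal with hc₀
  have hc₀' : 0 < c₀ := mul_pos (by positivity) (ENNReal.toReal_pos
    (measure_ball_pos _ _ (by norm_num)).ne' measure_ball_lt_top.ne)
  have hLam0 : 0 < Lam := hlam.trans_le hLam
  -- The terms of `Q` pay, in units of `μ * s`, for the right-hand side, for paraboloid and tail,
  -- and for the drift `32 * inner ℝ x₁ b` with `‖x₁‖ < 3 / 8`.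
  set Q := 1 + 16 * Lam * J + 12 * |β| with hQ
  have hQ0 : 0 < Q := by positivity
  refine ⟨min (1 / 8) (c₀ / (2 * Q)), lt_min (by norm_num) (by positivity), min_le_left _ _, ?_⟩
  set μ := min (1 / 8) (c₀ / (2 * Q)) with hμdef
  have hμ : 0 < μ := lt_min (by norm_num) (by positivity)
  have hμ8 : μ ≤ 1 / 8 := min_le_left _ _
  have hμQ : μ * Q < c₀ := by
    have : μ * Q ≤ c₀ / (2 * Q) * Q := mul_le_mul_of_nonneg_right (min_le_right _ _) hQ0.le
    have h2 : c₀ / (2 * Q) * Q = c₀ / 2 := by field_simp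
    linarith
  clear_value μ J c₀ Q
  intro a b w ha hb hw hlip
  have hlip1 : LipOnBall w 0 1 (1 + μ) := by simpa using hlip 1 le_rfl
  suffices H : ∀ x ∈ ball (0 : Rn n) (1 / 8), ∀ y ∈ ball (0 : Rn n) (1 / 8),
      w x - w y ≤ (1 - μ) * ‖x - y‖ by
    intro x hx y hy
    rw [abs_le']
    refine ⟨H x hx y hy, ?_⟩
    rw [neg_sub, norm_sub_rev]
    exact H y hy x hx
  intro x₂ hx₂ y₂ hy₂
  by_contra! hcon
  rw [mem_ball_zero_iff] at hx₂ hy₂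
  obtain ⟨h, hh⟩ : ∃ h, h = x₂ - y₂ := ⟨_, rfl⟩
  obtain ⟨s, hs⟩ : ∃ s, s = ‖h‖ := ⟨_, rfl⟩
  have hy₂' : y₂ = x₂ - h := by rw [hh]; abel
  rw [← hh, ← hs] at hcon
  have h0 : h ≠ 0 := by
    rintro rfl
    rw [hy₂', hs] at hcon
    simp at hcon
  have hs0 : 0 < s := hs ▸ norm_pos_iff.2 h0
  have hs4 : s ≤ 1 / 4 := by
    rw [hs, hh]; linarith [norm_sub_le x₂ y₂]
  obtain ⟨M, hM⟩ := hw.lipschitz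
  set v : Rn n → ℝ := fun x => w x - w (x - h) with hv
  have hvc : Continuous v :=
    hM.continuous.sub (hM.continuous.comp (continuous_id.sub continuous_const))
  have hvM : ∀ x, |v x| ≤ M * s := fun x => by
    have := hM.dist_le_mul x (x - h)
    rwa [Real.dist_eq, dist_eq_norm, sub_sub_cancel, ← hs] at this
  have hvR : ∀ x : Rn n, ∀ R : ℝ, 1 ≤ R → ‖x‖ + s < R → v x ≤ (1 + μ * R ^ (1 - ε)) * s := by
    intro x R hR hxR
    have h2 := hlip R hR x (by rw [mem_ball_zero_iff]; linarith) (x - h)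
      (by rw [mem_ball_zero_iff]; linarith [norm_sub_le x h])
    rw [sub_sub_cancel, ← hs] at h2
    exact (le_abs_self _).trans h2
  -- The penalty costs at most `μ * s / 4` at `x₂`. At the maximum it must be below `9 / 4 * μ * s`,
  -- which puts `x₁` in the ball of radius `3 / 8` and lets the paraboloid touch in a ball of that
  -- radius around `x₁`.
  obtain ⟨x₁, hx₁, hmax⟩ := (isCompact_closedBall (0 : Rn n) (3 / 4)).exists_isMaxOn
    (f := fun x => v x - 16 * μ * s * ‖x‖ ^ 2) ⟨0, mem_closedBall_self (by norm_num)⟩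
    (by fun_prop)
  rw [isMaxOn_iff] at hmax
  rw [mem_closedBall_zero_iff] at hx₁
  have h₂ := hmax x₂ (by rw [mem_closedBall_zero_iff]; linarith)
  have hvx₂ : (1 - μ) * s < v x₂ := by rw [hv]; beta_reduce; rw [← hy₂']; exact hcon
  have hx₂sq : ‖x₂‖ ^ 2 ≤ 1 / 64 := by nlinarith [norm_nonneg x₂]
  have hμs : 0 < μ * s := mul_pos hμ hs0
  have hvx₁' : (1 - μ) * s - μ * s / 4 < v x₁ - 16 * μ * s * ‖x₁‖ ^ 2 := by
    have h3 := mul_le_mul_of_nonneg_left hx₂sq hμs.le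
    linarith
  have hvx₁ : (1 - 2 * μ) * s < v x₁ := by
    have h3 := mul_nonneg hμs.le (sq_nonneg ‖x₁‖)
    linarith
  have hvx₁up : v x₁ ≤ (1 + μ) * s := by
    have h3 := hlip1 x₁ (by rw [mem_ball_zero_iff]; linarith) (x₁ - h)
      (by
        have := hlip 1 le_rfl
        rw [mem_ball_zero_iff]
        have h5 := norm_sub_le x₂ y₂
        rw [← hh, ← hs] at h5
        linarith [norm_sub_le x₁ h])
    rw [sub_sub_cancel, ← hs] at h3
    exact (le_abs_self _).trans h3
  have hx₁' : ‖x₁‖ < 3 / 8 := by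
    have : μ * s * ‖x₁‖ ^ 2 < μ * s * (9 / 64) := by linarith
    have h3 := lt_of_mul_lt_mul_left this hμs.le
    nlinarith [norm_nonneg x₁]
  set φ : Rn n → ℝ := fun x => v x₁ + 16 * μ * s * (‖x‖ ^ 2 - ‖x₁‖ ^ 2) with hφ
  have hφ2 : ContDiff ℝ 2 φ :=
    contDiff_const.add (contDiff_const.mul ((contDiff_norm_sq ℝ).sub contDiff_const))
  have hx₁pos : w (x₁ - h) < w x₁ := by
    have : 0 < v x₁ := lt_of_le_of_lt (mul_nonneg (by linarith) hs0.le) hvx₁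
    exact sub_pos.1 this
  have htest := hw.subsolution h x₁ ⟨hx₁pos, by rw [mem_ball_zero_iff]; linarith⟩ (3 / 8)
    (by norm_num) φ hφ2 (by simp [hφ, hv]) (by
      intro x hx
      rw [dist_eq_norm] at hx
      have h3 : ‖x‖ ≤ 3 / 4 := by
        have := norm_add_le (x - x₁) x₁
        rw [sub_add_cancel] at this
        linarith
      have h4 := hmax x (by rwa [mem_closedBall_zero_iff])
      simp only [hφ]
      linarith)
  set g := glue φ v x₁ (3 / 8) with hg
  have hgx₁ : g x₁ = v x₁ := by simp [hg, glue, hφ]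
  have hgin : ∀ x, dist x x₁ < 3 / 8 → g x = φ x := fun x hx => if_pos hx
  have hgout : ∀ x, ¬ dist x x₁ < 3 / 8 → g x = v x := fun x hx => if_neg hx
  have hgp : ∀ y : Rn n, 3 / 8 ≤ ‖y‖ → g (x₁ + y) = v (x₁ + y) := fun y hy =>
    hgout _ (by simpa using hy)
  have hgm : ∀ y : Rn n, 3 / 8 ≤ ‖y‖ → g (x₁ - y) = v (x₁ - y) := fun y hy =>
    hgout _ (by simpa using hy)
  have hvfar : ∀ x y : Rn n, 3 / 8 ≤ ‖y‖ → ‖x‖ ≤ 3 / 8 + ‖y‖ →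
      v x ≤ s + 4 * (μ * s) * ‖y‖ ^ (1 - ε) := by
    intro x y hy hxy
    have h3 := hvR x (‖y‖ + 1) (by linarith) (by linarith)
    have h4 := mul_le_mul_of_nonneg_left (add_one_rpow_le_of_far hε.le hε' hy) hμs.le
    linarith
  -- This `p` makes `x₁ + y` range over the ball of radius `1 / 4` around `-h/‖h‖`, where the
  -- increment is at most `s / 2`.
  have hop := nonlocalOp_le_of_secondDiff_le hn hlam hε hε' ha (g := g) (x := x₁)
    (κ := 16 * μ * s) (B := 2 * (M * s)) (s := s) (p := -x₁ - ‖h‖⁻¹ • h) ?_ hs0.le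
    (by positivity) ?_ ?_ ?_ ?_
  rotate_left
  · exact Measurable.ite (measurableSet_lt (by fun_prop) measurable_const)
      hφ2.continuous.measurable hvc.measurable
  · intro y hy
    rw [hgin _ (by simpa using hy), hgin _ (by simpa using hy), hgx₁]
    have h3 := parallelogram_law_with_norm ℝ x₁ y
    simp only [hφ]
    linear_combination (16 * μ * s / 2) * h3
  · intro y hy
    rw [hgp y hy, hgm y hy, hgx₁]
    have h3 := abs_le.1 (hvM (x₁ + y))
    have h4 := abs_le.1 (hvM (x₁ - y))
    have h5 := abs_le.1 (hvM x₁)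
    rw [abs_le]
    constructor <;> linarith
  · intro y hy
    rw [hgp y hy, hgm y hy, hgx₁]
    have h3 := hvfar (x₁ + y) y hy ((norm_add_le _ _).trans (by linarith))
    have h4 := hvfar (x₁ - y) y hy ((norm_sub_le _ _).trans (by linarith))
    have h5 := mul_le_mul_of_nonneg_left (one_le_rpow_of_far hε.le hε' hy) hμs.le
    linarith
  · intro y hy
    have hye : ‖(x₁ + y) + ‖h‖⁻¹ • h‖ < 1 / 4 := by
      rw [mem_ball, dist_eq_norm] at hy
      have h3 : x₁ + y + ‖h‖⁻¹ • h = y - (-x₁ - ‖h‖⁻¹ • h) := by abel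
      rwa [h3]
    have he1 : ‖‖h‖⁻¹ • h‖ = 1 := norm_smul_inv_norm h0
    have hy3 : 3 / 8 ≤ ‖y‖ := by
      have h4 : ‖‖h‖⁻¹ • h‖ ≤ ‖(x₁ + y) + ‖h‖⁻¹ • h‖ + ‖x₁ + y‖ := by
        simpa using norm_sub_le ((x₁ + y) + ‖h‖⁻¹ • h) (x₁ + y)
      linarith [norm_add_le x₁ y]
    have hy2 : ‖y‖ ≤ 2 := by
      have h4 : ‖y‖ ≤ ‖(x₁ + y) + ‖h‖⁻¹ • h‖ + ‖x₁ + ‖h‖⁻¹ • h‖ := by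
        have := norm_sub_le ((x₁ + y) + ‖h‖⁻¹ • h) (x₁ + ‖h‖⁻¹ • h)
        simpa using this
      linarith [norm_add_le x₁ (‖h‖⁻¹ • h)]
    refine ⟨hy3, hy2, ?_⟩
    rw [hgp y hy3, hgm y hy3, hgx₁]
    have h3 : v (x₁ + y) ≤ s / 2 := by
      have := hw.sub_le_half hμ hμ8 hlip1 h0 (hs ▸ hs4) hye
      rwa [← hs] at this
    have h4 := hvfar (x₁ - y) y hy3 ((norm_sub_le _ _).trans (by linarith))
    have h5 := mul_le_mul_of_nonneg_left (one_le_rpow_of_far hε.le hε' hy3) hμs.le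
    linarith
  have hfd : fderiv ℝ g x₁ b = 16 * μ * s * (2 * inner ℝ x₁ b) := by
    have hev : g =ᶠ[𝓝 x₁] φ := by
      filter_upwards [ball_mem_nhds x₁ (by norm_num : (0 : ℝ) < 3 / 8)] with x hx using hgin x hx
    have hd : HasFDerivAt φ ((16 * μ * s) • (2 • innerSL ℝ x₁)) x₁ :=
      (((hasStrictFDerivAt_norm_sq x₁).hasFDerivAt.sub_const _).const_mul _).const_add _
    rw [hev.fderiv_eq, hd.fderiv]
    simp
  have hinner : -(3 / 8 * |β|) ≤ inner ℝ x₁ b := by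
    have h3 := abs_le.1 (abs_real_inner_le_norm x₁ b)
    rw [hb] at h3
    have h4 : ‖x₁‖ * β ≤ 3 / 8 * |β| :=
      mul_le_mul hx₁'.le (le_abs_self β) (hb ▸ norm_nonneg b) (by norm_num)
    linarith [h3.1]
  have hdr : 16 * μ * s * (2 * -(3 / 8 * |β|)) ≤ fderiv ℝ g x₁ b := by
    rw [hfd]; gcongr
  unfold driftOp at htest
  rw [← hs] at htest
  rw [← hJ, ← hc₀] at hop
  have hend : s * c₀ ≤ s * (μ * Q) := by
    rw [hQ]; linarith
  exact absurd (le_of_mul_le_mul_left hend hs0) (not_le.2 hμQ)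

/-! ### Rescaling of almost convex solutions -/

theorem LipOnBall.mono {n : ℕ} {w : Rn n → ℝ} {z z' : Rn n} {r r' c c' : ℝ}
    (hw : LipOnBall w z r c) (hball : ball z' r' ⊆ ball z r) (hc : c ≤ c') :
    LipOnBall w z' r' c' :=
  fun x hx y hy => (hw x (hball hx) y (hball hy)).trans
    (mul_le_mul_of_nonneg_right hc (norm_nonneg _))

theorem sq_norm_convex_combination {n : ℕ} (p q : Rn n) {s t : ℝ} (hst : s + t = 1) :
    s * ‖p‖ ^ 2 + t * ‖q‖ ^ 2 - ‖s • p + t • q‖ ^ 2 = s * t * ‖p - q‖ ^ 2 := by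
  obtain rfl : t = 1 - s := by linarith
  rw [norm_add_sq_real, norm_sub_sq_real, norm_smul, norm_smul, inner_smul_left,
    inner_smul_right, mul_pow, mul_pow, Real.norm_eq_abs, Real.norm_eq_abs, sq_abs, sq_abs]
  simp only [conj_trivial]
  ring

theorem SemiconvexOn.le_add {n : ℕ} {K : ℝ} {U : Set (Rn n)} {u : Rn n → ℝ}
    (hu : SemiconvexOn K U u) {x y : Rn n} (hx : x ∈ U) (hy : y ∈ U) {s t : ℝ} (hs : 0 ≤ s)
    (ht : 0 ≤ t) (hst : s + t = 1) :
    u (s • x + t • y) ≤ s * u x + t * u y + K / 2 * (s * t * ‖x - y‖ ^ 2) := by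
  have h1 := hu.2 hx hy hs ht hst
  simp only [smul_eq_mul] at h1
  rw [← sq_norm_convex_combination x y hst]
  linarith

/-- Rescaling after subtraction of a supporting affine function. -/
theorem AlmostConvexSolution.of_affine {n : ℕ} {a u : Rn n → ℝ} {b x₀ : Rn n} {K μ r A : ℝ}
    {U : Set (Rn n)} {Ω : Rn n → Set (Rn n)} (ℓ : Rn n →L[ℝ] ℝ)
    (hu : ∃ M : ℝ≥0, LipschitzWith M u) (hsc : SemiconvexOn K U u)
    (hsub : ∀ h, ViscositySubsolution a b (Ω h) (K * ‖h‖) (fun x => u x - u (x - h)))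
    (hr : 0 < r) (hA : 0 < A) (hμ : A * r ^ 2 * K ≤ μ)
    (hU : ∀ x ∈ ball (0 : Rn n) 2, x₀ + r • x ∈ U)
    (hsupp : ∀ z ∈ U, 0 ≤ u z - u x₀ - ℓ (z - x₀) + K / 2 * ‖z - x₀‖ ^ 2)
    (hΩ : ∀ h, ∀ z ∈ U, u (z - h) + ℓ h < u z → z ∈ Ω h) :
    AlmostConvexSolution (fun y => a (r • y)) b μ
      (fun x => A * (u (x₀ + r • x) - u x₀ - ℓ (r • x))) := by
  refine ⟨?_, by simp, ?_, ?_, ?_⟩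
  · obtain ⟨M, hM⟩ := hu
    have h1 : LipschitzWith (M * ‖r‖₊) (fun x : Rn n => u (x₀ + r • x)) :=
      hM.comp (LipschitzWith.of_dist_le_mul fun x y => by
        rw [dist_add_left, dist_smul₀, coe_nnnorm])
    have h2 : LipschitzWith (‖ℓ‖₊ * ‖r‖₊) (fun x : Rn n => ℓ (r • x)) :=
      ℓ.lipschitz.comp (LipschitzWith.of_dist_le_mul fun x y => by
        rw [dist_smul₀, coe_nnnorm])
    have h3 := (h1.sub (LipschitzWith.const (u x₀))).sub h2
    exact ⟨_, (ContinuousLinearMap.lipschitz (ContinuousLinearMap.mul ℝ ℝ A)).comp h3⟩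
  · intro x hx
    have h1 := hsupp _ (hU x hx)
    rw [add_sub_cancel_left, norm_smul, Real.norm_of_nonneg hr.le] at h1
    have h2 := mul_le_mul_of_nonneg_right hμ (sq_nonneg ‖x‖)
    have h3 := mul_nonneg hA.le h1
    linarith
  · refine ⟨convex_ball _ _, fun x hx y hy s t hs ht hst => ?_⟩
    have h4 := hsc.le_add (hU x hx) (hU y hy) hs ht hst
    have hcomb : s • (x₀ + r • x) + t • (x₀ + r • y) = x₀ + r • (s • x + t • y) := by
      rw [smul_add, smul_add, smul_add, smul_comm s r, smul_comm t r, add_add_add_comm, ← add_smul,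
        hst, one_smul]
    have h3 := sq_norm_convex_combination x y hst
    rw [hcomb, add_sub_add_left_eq_sub, ← smul_sub, norm_smul, Real.norm_of_nonneg hr.le] at h4
    simp only [smul_eq_mul]
    have hℓ : ℓ (r • (s • x + t • y)) = s * ℓ (r • x) + t * ℓ (r • y) := by
      simp only [map_smul, map_add, smul_eq_mul]; ring
    rw [hℓ]
    have h5 := mul_le_mul_of_nonneg_left h4 hA.le
    have h6 := mul_le_mul_of_nonneg_right hμ (by positivity : 0 ≤ s * t * ‖x - y‖ ^ 2)
    have h7 : A * (u x₀) = A * (s * u x₀ + t * u x₀) := by rw [← add_mul, hst, one_mul]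
    linear_combination h5 + h6 / 2 - μ / 2 * h3 - h7
  · intro h
    -- Subtracting `ℓ` changes an increment only by the constant `ℓ (r • h)`, which the viscosity
    -- inequality does not see.
    have h1 := (hsub (r • h)).comp_affine x₀ hr hA (ℓ (r • h))
    have h2 : (fun x => A * (u (x₀ + r • x) - u (x₀ + r • x - r • h) - ℓ (r • h))) =
        fun x => A * (u (x₀ + r • x) - u x₀ - ℓ (r • x)) -
          A * (u (x₀ + r • (x - h)) - u x₀ - ℓ (r • (x - h))) := by
      funext x
      rw [smul_sub, map_sub, add_sub_assoc]
      ring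
    rw [h2] at h1
    refine h1.mono ?_ ?_
    · rintro x ⟨hx1, hx2⟩
      refine hΩ _ _ (hU x hx2) ?_
      have h3 := lt_of_mul_lt_mul_left hx1 hA.le
      rw [smul_sub, map_sub, ← add_sub_assoc] at h3
      linarith
    · rw [norm_smul, Real.norm_of_nonneg hr.le]
      have h3 := mul_le_mul_of_nonneg_right hμ (norm_nonneg h)
      linarith

theorem AlmostConvexSolution.rescale {n : ℕ} {a w : Rn n → ℝ} {b : Rn n} {δ μ r A : ℝ}
    (hw : AlmostConvexSolution a b δ w) (hr : 0 < r) (hr1 : r ≤ 1) (hA : 0 < A)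
    (hμ : A * r ^ 2 * δ ≤ μ) :
    AlmostConvexSolution (fun y => a (r • y)) b μ (fun x => A * w (r • x)) := by
  have := AlmostConvexSolution.of_affine (x₀ := 0) (r := r) (A := A) (U := ball 0 2) 0
    hw.lipschitz hw.semiconvex hw.subsolution hr hA hμ ?_ ?_ ?_
  · simpa [hw.zero] using this
  · intro x hx
    rw [mem_ball_zero_iff] at hx ⊢
    rw [zero_add, norm_smul, Real.norm_of_nonneg hr.le]
    nlinarith [norm_nonneg x]
  · intro z hz
    simpa [hw.zero] using hw.nonneg z hz
  · intro h z hz hlt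
    exact ⟨by simpa using hlt, hz⟩

/-! ### Iteration over the scales -/

/-- Bernoulli for `√s` with exponent `2 * τ`. Growth like `√s`, unlike linear growth, is absorbed by
`R ^ (1 - ε)` when `ε ≤ 1 / 2`. -/
theorem rpow_le_one_add_sqrt {s τ : ℝ} (hs : 1 ≤ s) (hτ : 0 ≤ τ) (hτ' : 2 * τ ≤ 1) :
    s ^ τ ≤ 1 + 2 * τ * (√s - 1) := by
  have h1 : s ^ τ = (1 + (√s - 1)) ^ (2 * τ) := by
    rw [add_sub_cancel, Real.sqrt_eq_rpow, ← Real.rpow_mul (by linarith)]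
    congr 1; ring
  rw [h1]
  exact rpow_one_add_le_one_add_mul_self (by linarith [Real.sqrt_nonneg s]) (by linarith) hτ'

/-- Almost convex solutions with small constant `δ` and growth are `C^{1,τ}` at the origin. -/
def HolderDecay (n : ℕ) (lam Lam ε β τ δ : ℝ) : Prop :=
  ∀ (a : Rn n → ℝ) (b : Rn n) (w : Rn n → ℝ),
    IsEllipticKernel lam Lam a → ‖b‖ = β → AlmostConvexSolution a b δ w →
    (∀ R : ℝ, 1 ≤ R → LipOnBall w 0 R (δ * R ^ (1 - ε))) →
    ∀ r : ℝ, 0 < r → r ≤ 1 → LipOnBall w 0 r ((8 * r) ^ τ)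

set_option maxHeartbeats 1000000 in
/-- Small almost convex solutions are `C^{1,τ}` at the origin. -/
theorem exists_holder_decay {n : ℕ} (hn : 1 ≤ n) {lam : ℝ} (hlam : 0 < lam) {Lam : ℝ}
    (hLam : lam ≤ Lam) {ε : ℝ} (hε : 0 < ε) (hε' : ε ≤ 1 / 2) (β : ℝ) :
    ∃ τ δ : ℝ, 0 < τ ∧ τ ≤ 1 / 2 ∧ 0 < δ ∧ δ ≤ 1 ∧
      HolderDecay n lam Lam ε β τ δ := by
  obtain ⟨μ, hμ, hμ8, H⟩ := exists_lipOnBall_improvement hn hlam hLam hε (by linarith) β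
  have hs8 : √8 ≤ 3 := by rw [Real.sqrt_le_left (by norm_num)]; norm_num
  -- As `√8 ≤ 3`, this choice gives `8 ^ τ ≤ 1 + μ / 3`, hence `8 ^ τ * (1 - μ) ≤ 1`, and makes `6 *
  -- τ` equal to `μ / 2`.
  obtain ⟨τ, hτ⟩ : ∃ τ, τ = μ / 12 := ⟨_, rfl⟩
  have hτ0 : 0 < τ := by rw [hτ]; positivity
  have hτ2 : τ ≤ 1 / 2 := by linarith
  refine ⟨τ, μ / 2, hτ0, hτ2, by positivity, by linarith, ?_⟩
  intro a b w ha hb hw hlip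
  have h8τ : (8 : ℝ) ^ τ * (1 - μ) ≤ 1 := by
    have h1 := rpow_le_one_add_sqrt (s := 8) (by norm_num) hτ0.le (by linarith)
    have h2 : (8 : ℝ) ^ τ ≤ 1 + μ / 3 := by
      have : 2 * τ * (√8 - 1) ≤ 2 * τ * 2 := by gcongr; linarith
      linarith
    have h3 := mul_le_mul_of_nonneg_right h2 (by linarith : 0 ≤ 1 - μ)
    nlinarith
  have hgrowth : ∀ R : ℝ, 1 ≤ R → (8 * R) ^ τ ≤ 1 + μ / 2 * R ^ (1 - ε) := by
    intro R hR
    have h1 := rpow_le_one_add_sqrt (s := 8 * R) (by linarith) hτ0.le (by linarith)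
    have h2 : √(8 * R) ≤ 3 * R ^ (1 - ε) := by
      rw [Real.sqrt_mul (by norm_num)]
      have : √R ≤ R ^ (1 - ε) := by
        rw [Real.sqrt_eq_rpow]
        exact Real.rpow_le_rpow_of_exponent_le hR (by linarith)
      exact mul_le_mul hs8 this (Real.sqrt_nonneg _) (by norm_num)
    have h3 : 2 * τ * (√(8 * R) - 1) ≤ 2 * τ * (3 * R ^ (1 - ε)) := by gcongr; linarith
    rw [hτ] at h1 h3 ⊢
    linarith
  -- The first bound is sharp at the scale `8⁻ᵏ`; the second loses `8 ^ τ` between scales and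
  -- supplies the growth hypothesis at the next step.
  have key : ∀ k : ℕ, LipOnBall w 0 ((1 / 8) ^ k) (((1 / 8 : ℝ) ^ k) ^ τ) ∧
      ∀ R : ℝ, (1 / 8) ^ k ≤ R → R ≤ 1 → LipOnBall w 0 R ((8 * R) ^ τ) := by
    intro k
    induction k with
    | zero =>
      have h1 : LipOnBall w 0 1 1 := (hlip 1 le_rfl).mono Subset.rfl (by
        rw [Real.one_rpow]; linarith)
      refine ⟨by simpa using h1, fun R hR1 hR2 => ?_⟩
      rw [pow_zero] at hR1
      obtain rfl : R = 1 := le_antisymm hR2 hR1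
      exact h1.mono Subset.rfl (Real.one_le_rpow (by norm_num) hτ0.le)
    | succ k ih =>
      obtain ⟨ih1, ih2⟩ := ih
      obtain ⟨q, hq⟩ : ∃ q : ℝ, q = (1 / 8) ^ k := ⟨_, rfl⟩
      rw [← hq] at ih1 ih2
      have hq0 : 0 < q := by rw [hq]; positivity
      have hq1 : q ≤ 1 := by rw [hq]; exact pow_le_one₀ (by norm_num) (by norm_num)
      have hqτ : 0 < q ^ τ := Real.rpow_pos_of_pos hq0 _
      have hqq : q ≤ q ^ τ := by
        conv_lhs => rw [← Real.rpow_one q]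
        exact Real.rpow_le_rpow_of_exponent_ge hq0 hq1 (by linarith)
      obtain ⟨A, hA⟩ : ∃ A, A = (q * q ^ τ)⁻¹ := ⟨_, rfl⟩
      have hA0 : 0 < A := by rw [hA]; positivity
      have hAq : A * (q * q ^ τ) = 1 := by rw [hA]; field_simp
      have hscale : ∀ R c : ℝ, LipOnBall w 0 (q * R) (c * q ^ τ) →
          LipOnBall (fun x => A * w (q • x)) 0 R c := by
        intro R c hc x hx y hy
        rw [mem_ball_zero_iff] at hx hy
        have hmem : ∀ x : Rn n, ‖x‖ < R → q • x ∈ ball (0 : Rn n) (q * R) := by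
          intro x hx
          rw [mem_ball_zero_iff, norm_smul, Real.norm_of_nonneg hq0.le]
          gcongr
        have h1 := hc _ (hmem x hx) _ (hmem y hy)
        rw [← smul_sub, norm_smul, Real.norm_of_nonneg hq0.le] at h1
        rw [← mul_sub, abs_mul, abs_of_pos hA0]
        refine (mul_le_mul_of_nonneg_left h1 hA0.le).trans (le_of_eq ?_)
        linear_combination (c * ‖x - y‖) * hAq
      have hgood : AlmostConvexSolution (fun y => a (q • y)) b μ (fun x => A * w (q • x)) := by
        refine hw.rescale hq0 hq1 hA0 ?_
        -- Normalizing the slope by `q ^ τ` does not spoil almost convexity, because `q ≤ q ^ τ`.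
        have h1 : A * q ^ 2 ≤ 1 := by
          rw [← hAq, sq]
          gcongr
        have := mul_le_mul_of_nonneg_right h1 (by positivity : 0 ≤ μ / 2)
        linarith
      have himp := H _ b _ (ha.comp_smul hq0) hb hgood (by
        intro R hR
        have hRε : 0 ≤ R ^ (1 - ε) := Real.rpow_nonneg (by linarith) _
        rcases le_total (q * R) 1 with hqR | hqR
        · have h1 := ih2 (q * R) (by nlinarith) hqR
          have h2 : (8 * (q * R)) ^ τ = (8 * R) ^ τ * q ^ τ := by
            rw [← Real.mul_rpow (by linarith) hq0.le]; congr 1; ring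
          rw [h2] at h1
          refine (hscale R _ h1).mono Subset.rfl ((hgrowth R hR).trans ?_)
          gcongr; linarith
        · have h1 := hlip (q * R) hqR
          have h2 : μ / 2 * (q * R) ^ (1 - ε) ≤ μ / 2 * R ^ (1 - ε) * q ^ τ := by
            rw [Real.mul_rpow hq0.le (by linarith), mul_assoc (μ / 2), mul_comm (q ^ (1 - ε))]
            have : q ^ (1 - ε) ≤ q ^ τ := Real.rpow_le_rpow_of_exponent_ge hq0 hq1 (by linarith)
            gcongr
          refine (hscale R _ (h1.mono Subset.rfl h2)).mono Subset.rfl ?_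
          have : μ / 2 * R ^ (1 - ε) ≤ μ * R ^ (1 - ε) := by gcongr; linarith
          linarith)
      have hpow : (1 / 8 : ℝ) ^ (k + 1) = q / 8 := by rw [pow_succ, ← hq]; ring
      rw [hpow]
      have hq8 : (q / 8) ^ τ * 8 ^ τ = q ^ τ := by
        rw [← Real.mul_rpow (by positivity) (by norm_num)]; congr 1; ring
      have hstep : LipOnBall w 0 (q / 8) ((q / 8) ^ τ) := by
        intro x hx y hy
        have hmem : ∀ x ∈ ball (0 : Rn n) (q / 8), q⁻¹ • x ∈ ball (0 : Rn n) (1 / 8) := by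
          intro x hx
          rw [mem_ball_zero_iff] at hx ⊢
          rw [norm_smul, norm_inv, Real.norm_of_nonneg hq0.le]
          have := mul_lt_mul_of_pos_left hx (inv_pos.2 hq0)
          refine this.trans_le (le_of_eq ?_)
          field_simp
        have h1 := himp _ (hmem x hx) _ (hmem y hy)
        simp only [smul_smul, mul_inv_cancel₀ hq0.ne', one_smul] at h1
        rw [← smul_sub, norm_smul, norm_inv, Real.norm_of_nonneg hq0.le, ← mul_sub, abs_mul,
          abs_of_pos hA0] at h1
        have h2 := mul_le_mul_of_nonneg_left h1 (by positivity : 0 ≤ q * q ^ τ)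
        have h3 : |w x - w y| ≤ (1 - μ) * q ^ τ * ‖x - y‖ := by
          have h4 : q * q ^ τ * (A * |w x - w y|) = |w x - w y| := by
            linear_combination |w x - w y| * hAq
          have h5 : q * q ^ τ * ((1 - μ) * (q⁻¹ * ‖x - y‖)) = (1 - μ) * q ^ τ * ‖x - y‖ := by
            field_simp
          linarith
        refine h3.trans (mul_le_mul_of_nonneg_right ?_ (norm_nonneg _))
        rw [← hq8]
        have h6 := mul_le_mul_of_nonneg_left h8τ (by positivity : 0 ≤ (q / 8) ^ τ)
        linarith
      refine ⟨hstep, fun R hR1 hR2 => ?_⟩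
      rcases le_total q R with h | h
      · exact ih2 R h hR2
      · exact ih1.mono (ball_subset_ball h) (Real.rpow_le_rpow hq0.le (by linarith) hτ0.le)
  intro r hr hr1
  obtain ⟨k, hk⟩ := exists_pow_lt_of_lt_one hr (by norm_num : (1 / 8 : ℝ) < 1)
  exact (key k).2 r hk.le hr1

/-! ### Supporting paraboloids and Lipschitz bounds for semiconvex functions -/

/-- A semiconvex function lies above a paraboloid touching it at a point of differentiability. -/
theorem SemiconvexOn.fderiv_le {n : ℕ} {K : ℝ} (hK : 0 ≤ K) {U : Set (Rn n)} {u : Rn n → ℝ}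
    (hu : SemiconvexOn K U u) {x z : Rn n} (hx : x ∈ U) (hz : z ∈ U)
    (hd : DifferentiableAt ℝ u x) :
    0 ≤ u z - u x - fderiv ℝ u x (z - x) + K / 2 * ‖z - x‖ ^ 2 := by
  have hline : HasDerivAt (fun t : ℝ => u (x + t • (z - x))) (fderiv ℝ u x (z - x)) 0 := by
    have h1 : HasDerivAt (fun t : ℝ => x + t • (z - x)) (z - x) 0 := by
      simpa using ((hasDerivAt_id (0 : ℝ)).smul_const (z - x)).const_add x
    have h2 : HasFDerivAt u (fderiv ℝ u x) (x + (0 : ℝ) • (z - x)) := by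
      simpa using hd.hasFDerivAt
    exact h2.comp_hasDerivAt 0 h1
  have hlim := hline.tendsto_slope_zero_right
  have hle : fderiv ℝ u x (z - x) ≤ u z - u x + K / 2 * ‖z - x‖ ^ 2 := by
    refine le_of_tendsto hlim ?_
    filter_upwards [Ioc_mem_nhdsGT (zero_lt_one' ℝ)] with t ht
    have h1 := hu.le_add hx hz (by linarith [ht.2] : 0 ≤ 1 - t) ht.1.le (by ring)
    have h2 : (1 - t) • x + t • z = x + t • (z - x) := by module
    rw [h2, norm_sub_rev] at h1
    simp only [zero_add, zero_smul, add_zero, smul_eq_mul]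
    rw [inv_mul_le_iff₀ ht.1]
    have h3 : K / 2 * ((1 - t) * t * ‖z - x‖ ^ 2) ≤ K / 2 * (1 * t * ‖z - x‖ ^ 2) := by
      have := ht.1
      gcongr
      linarith
    linarith
  linarith

/-- Near the origin the Lipschitz bound follows from the one in an annulus and semiconvexity. -/
theorem SemiconvexOn.lipOnBall_of_annulus {n : ℕ} {K : ℝ} (hK : 0 ≤ K) {u : Rn n → ℝ}
    (hu : SemiconvexOn K (ball 0 2) u) {T : ℝ}
    (hT : ∀ z : Rn n, 1 / 2 ≤ ‖z‖ → ‖z‖ ≤ 3 / 2 → LipOnBall u z (1 / 4) T) :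
    LipOnBall u 0 (1 / 2) (T + 3 * K) := by
  suffices H : ∀ x ∈ ball (0 : Rn n) (1 / 2), ∀ y ∈ ball (0 : Rn n) (1 / 2), x ≠ y →
      u y - u x ≤ (T + 3 * K) * ‖y - x‖ by
    intro x hx y hy
    rcases eq_or_ne x y with rfl | hxy
    · simp
    rw [abs_le', neg_sub]
    refine ⟨H y hy x hx hxy.symm, ?_⟩
    rw [norm_sub_rev]
    exact H x hx y hy hxy
  intro x hx y hy hxy
  rw [mem_ball_zero_iff] at hx hy
  obtain ⟨d, hd⟩ : ∃ d, d = ‖y - x‖ := ⟨_, rfl⟩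
  have hd0 : 0 < d := by rw [hd, norm_pos_iff]; exact sub_ne_zero.2 hxy.symm
  obtain ⟨e, he⟩ : ∃ e, e = d⁻¹ • (y - x) := ⟨_, rfl⟩
  have hen : ‖e‖ = 1 := by
    rw [he, norm_smul, norm_inv, Real.norm_of_nonneg hd0.le, ← hd, inv_mul_cancel₀ hd0.ne']
  have hxe : y + (-d) • e = x := by
    rw [he, smul_smul, neg_mul, mul_inv_cancel₀ hd0.ne', neg_one_smul]; abel
  have hW : ConvexOn ℝ (ball 0 2) (fun x => u x + K / 2 * ‖x‖ ^ 2) := hu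
  have hg := hW.comp_affineMap (AffineMap.lineMap y (y + e) : ℝ →ᵃ[ℝ] Rn n)
  have hline : ∀ t : ℝ, (AffineMap.lineMap y (y + e) : ℝ →ᵃ[ℝ] Rn n) t = y + t • e := by
    intro t
    rw [AffineMap.lineMap_apply_module']
    rw [add_sub_cancel_left, add_comm]
  have hmem : ∀ t : ℝ, |t| ≤ 9 / 8 → t ∈ (AffineMap.lineMap y (y + e) : ℝ →ᵃ[ℝ] Rn n) ⁻¹'
      ball 0 2 := by
    intro t ht
    rw [mem_preimage, hline, mem_ball_zero_iff]
    have := norm_add_le y (t • e)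
    rw [norm_smul, hen, mul_one, Real.norm_eq_abs] at this
    linarith
  have hd1 : d ≤ 1 := by rw [hd]; linarith [norm_sub_le y x]
  have hm1 := hmem (-d) (by rw [abs_neg, abs_of_pos hd0]; linarith)
  have hm2 := hmem 1 (by norm_num)
  have hm3 := hmem 0 (by norm_num)
  have hm4 := hmem (9 / 8) (by norm_num [abs_of_pos])
  -- Chord slopes of a convex function increase: the one over `[-d, 0]` is at most the one over `[1,
  -- 9 / 8]`, whose left endpoint `y + e` lies in the annulus.
  have hs1 := hg.slope_mono_adjacent hm1 hm2 (by linarith : -d < 0) zero_lt_one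
  have hs2 := hg.slope_mono_adjacent hm3 hm4 zero_lt_one (by norm_num : (1 : ℝ) < 9 / 8)
  simp only [Function.comp_apply, hline, hxe, zero_smul, add_zero, one_smul] at hs1 hs2
  have hs := hs1.trans hs2
  rw [zero_sub, neg_neg, div_le_iff₀ hd0] at hs
  have hp1 : ‖y + e‖ ≤ 3 / 2 := by linarith [norm_add_le y e]
  have hp2 : 1 / 2 ≤ ‖y + e‖ := by
    have : ‖e‖ ≤ ‖y + e‖ + ‖y‖ := by simpa using norm_sub_le (y + e) y
    linarith
  have hdiff : (y + (9 / 8 : ℝ) • e) - (y + e) = (1 / 8 : ℝ) • e := by module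
  have hdn : ‖(y + (9 / 8 : ℝ) • e) - (y + e)‖ = 1 / 8 := by
    rw [hdiff, norm_smul, hen]; norm_num
  have hlip := hT (y + e) hp2 hp1 (y + (9 / 8 : ℝ) • e)
    (by rw [mem_ball, dist_eq_norm, hdn]; norm_num) (y + e) (by simp)
  rw [hdn] at hlip
  have hlip' := (le_abs_self _).trans hlip
  have hp3 : ‖y + (9 / 8 : ℝ) • e‖ ≤ ‖y + e‖ + 1 / 8 := by
    have := norm_add_le ((y + (9 / 8 : ℝ) • e) - (y + e)) (y + e)
    rw [hdn, sub_add_cancel] at this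
    linarith
  have hp4 : ‖y + (9 / 8 : ℝ) • e‖ ^ 2 - ‖y + e‖ ^ 2 ≤ 25 / 64 := by
    have := pow_le_pow_left₀ (norm_nonneg _) hp3 2
    nlinarith
  have hslope : (u (y + (9 / 8 : ℝ) • e) + K / 2 * ‖y + (9 / 8 : ℝ) • e‖ ^ 2 -
      (u (y + e) + K / 2 * ‖y + e‖ ^ 2)) / (9 / 8 - 1) ≤ T + 2 * K := by
    rw [div_le_iff₀ (by norm_num)]
    have h1 := mul_le_mul_of_nonneg_left hp4 (by positivity : 0 ≤ K / 2)
    linarith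
  have h1 := hs.trans (mul_le_mul_of_nonneg_right hslope hd0.le)
  have h2 : ‖x‖ ^ 2 - ‖y‖ ^ 2 ≤ 1 * d := by
    have h3 : ‖x‖ ≤ ‖y‖ + d := by
      rw [hd, norm_sub_rev]
      have := norm_add_le y (x - y)
      rwa [add_sub_cancel] at this
    have h4 : (‖x‖ - ‖y‖) * (‖x‖ + ‖y‖) ≤ d * (‖x‖ + ‖y‖) :=
      mul_le_mul_of_nonneg_right (by linarith) (by positivity)
    have h5 : d * (‖x‖ + ‖y‖) ≤ d * 1 := mul_le_mul_of_nonneg_left (by linarith) hd0.le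
    linarith
  have h3 := mul_le_mul_of_nonneg_left h2 (by positivity : 0 ≤ K / 2)
  have h4 : 0 ≤ K * d := by positivity
  rw [← hd]
  linarith

theorem LipOnBall.norm_fderiv_le {n : ℕ} {u : Rn n → ℝ} {z : Rn n} {r c : ℝ}
    (hu : LipOnBall u z r c) (hc : 0 ≤ c) {x : Rn n} (hx : x ∈ ball z r) :
    ‖fderiv ℝ u x‖ ≤ c := by
  refine norm_fderiv_le_of_lip' ℝ hc ?_
  filter_upwards [isOpen_ball.mem_nhds hx] with y hy using hu y hy x hx

/-- For `ε > 1` the gradient bound is singular at the origin. It is used only where `‖p‖ ≥ 1 / 4`,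
at the price of `4 ^ ε`, and semiconvexity fills in the middle. -/
theorem lipOnBall_of_gradient_growth {n : ℕ} {ε ε' : ℝ} (hε0 : 0 ≤ ε) (hε : ε' ≤ ε)
    (hε' : ε' ≤ 1) {K : ℝ} (hK : 0 ≤ K) {u : Rn n → ℝ} (hu : ∃ M : ℝ≥0, LipschitzWith M u)
    (hsc : SemiconvexOn K (ball 0 2) u)
    (hgrad : ∀ᵐ x : Rn n, ‖fderiv ℝ u x‖ ≤ K * (1 + ‖x‖ ^ (1 - ε)))
    (hε'0 : 0 ≤ ε') {R : ℝ} (hR : 1 ≤ R) :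
    LipOnBall u 0 R ((4 + 2 * 4 ^ ε) * K * R ^ (1 - ε')) := by
  obtain ⟨M, hM⟩ := hu
  obtain ⟨T, hT⟩ : ∃ T : ℝ, T = 4 ^ ε := ⟨_, rfl⟩
  have hT1 : 1 ≤ T := hT ▸ Real.one_le_rpow (by norm_num) hε0
  rw [← hT]
  have hpow : ∀ R : ℝ, 1 ≤ R → ∀ q : ℝ, 1 / 4 ≤ q → q ≤ R → q ^ (1 - ε) ≤ T * R ^ (1 - ε') := by
    intro R hR q hq hqR
    have hR1 : 1 ≤ R ^ (1 - ε') := Real.one_le_rpow hR (by linarith)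
    rcases le_total 1 q with h | h
    · have h1 : q ^ (1 - ε) ≤ q ^ (1 - ε') := Real.rpow_le_rpow_of_exponent_le h (by linarith)
      have h2 : q ^ (1 - ε') ≤ R ^ (1 - ε') := Real.rpow_le_rpow (by linarith) hqR (by linarith)
      nlinarith
    · have h1 : q ^ (1 - ε) ≤ q ^ (-ε) :=
        Real.rpow_le_rpow_of_exponent_ge (by linarith) h (by linarith)
      have h2 : q ^ (-ε) ≤ (1 / 4 : ℝ) ^ (-ε) :=
        Real.rpow_le_rpow_of_nonpos (by norm_num) hq (by linarith)
      have h3 : (1 / 4 : ℝ) ^ (-ε) = T := by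
        rw [hT, Real.rpow_neg (by norm_num), one_div, Real.inv_rpow (by norm_num), inv_inv]
      rw [h3] at h2
      nlinarith
  have hann : ∀ z : Rn n, 1 / 2 ≤ ‖z‖ → ‖z‖ ≤ 3 / 2 → LipOnBall u z (1 / 4) (K * (1 + 2 * T)) := by
    intro z hz1 hz2 x hx y hy
    refine hM.abs_sub_le_of_ae_norm_fderiv_le isOpen_ball (convex_ball z (1 / 4)) ?_ hy hx
    filter_upwards [hgrad] with p hp hpz
    rw [mem_ball, dist_eq_norm] at hpz
    have h1 : ‖p‖ ≤ 2 := by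
      have := norm_add_le (p - z) z
      rw [sub_add_cancel] at this; linarith
    have h2 : 1 / 4 ≤ ‖p‖ := by
      have : ‖z‖ ≤ ‖p‖ + ‖p - z‖ := by simpa using norm_sub_le p (p - z)
      linarith
    refine hp.trans (mul_le_mul_of_nonneg_left ?_ hK)
    have h3 := hpow 2 (by norm_num) ‖p‖ h2 h1
    have h4 : (2 : ℝ) ^ (1 - ε') ≤ 2 := by
      conv_rhs => rw [← Real.rpow_one 2]
      exact Real.rpow_le_rpow_of_exponent_le (by norm_num) (by linarith)
    nlinarith
  have hin := hsc.lipOnBall_of_annulus hK hann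
  have hR1 : 1 ≤ R ^ (1 - ε') := Real.one_le_rpow hR (by linarith)
  intro x hx y hy
  refine hM.abs_sub_le_of_ae_norm_fderiv_le isOpen_ball (convex_ball 0 R) ?_ hy hx
  filter_upwards [hgrad] with p hp hpR
  rw [mem_ball_zero_iff] at hpR
  rcases lt_or_ge ‖p‖ (1 / 2) with h | h
  · refine (hin.norm_fderiv_le (by positivity) (by rwa [mem_ball_zero_iff])).trans ?_
    have h1 : (4 + 2 * T) * K * 1 ≤ (4 + 2 * T) * K * R ^ (1 - ε') := by gcongr
    linarith
  · have h1 := hpow R hR ‖p‖ (by linarith) hpR.le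
    refine hp.trans ?_
    have h2 : 1 + ‖p‖ ^ (1 - ε) ≤ (4 + 2 * T) * R ^ (1 - ε') := by nlinarith
    have h3 := mul_le_mul_of_nonneg_left h2 hK
    linarith

/-! ### First-order expansions of the solution -/

/-- Nonnegative semiconvex functions whose increments are subsolutions where they are positive. -/
structure ObstacleSolution {n : ℕ} (a : Rn n → ℝ) (b : Rn n) (ε K C : ℝ) (u : Rn n → ℝ) :
    Prop where
  lipschitz : ∃ M : ℝ≥0, LipschitzWith M u
  zero : u 0 = 0
  nonneg : ∀ x, 0 ≤ u x
  semiconvex : SemiconvexOn K (ball 0 2) u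
  subsolution : ∀ h : Rn n, ViscositySubsolution a b ({x | 0 < u x} ∩ ball 0 2) (K * ‖h‖)
    (fun x => u x - u (x - h))
  growth : ∀ R : ℝ, 1 ≤ R → LipOnBall u 0 R (C * K * R ^ (1 - ε))

theorem LipOnBall.of_rescale {n : ℕ} {u : Rn n → ℝ} {x₀ : Rn n} {r A c ρ : ℝ} (hr : 0 < r)
    (hA : 0 < A) {k : ℝ} {ℓ : Rn n →L[ℝ] ℝ}
    (h : LipOnBall (fun x => A * (u (x₀ + r • x) - k - ℓ (r • x))) 0 ρ (A * r * c)) :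
    LipOnBall (fun x => u x - ℓ x) x₀ (r * ρ) c := by
  intro x hx y hy
  have hmem : ∀ x ∈ ball x₀ (r * ρ), r⁻¹ • (x - x₀) ∈ ball (0 : Rn n) ρ := by
    intro x hx
    rw [mem_ball, dist_eq_norm] at hx
    rw [mem_ball_zero_iff, norm_smul, norm_inv, Real.norm_of_nonneg hr.le, inv_mul_lt_iff₀ hr]
    exact hx
  have h1 := h _ (hmem x hx) _ (hmem y hy)
  simp only [smul_smul, mul_inv_cancel₀ hr.ne', one_smul, add_sub_cancel] at h1
  rw [← mul_sub, abs_mul, abs_of_pos hA, ← smul_sub, norm_smul, norm_inv,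
    Real.norm_of_nonneg hr.le, sub_sub_sub_cancel_right] at h1
  have h2 : A * |u x - ℓ x - (u y - ℓ y)| ≤ A * (c * ‖x - y‖) := by
    have e1 : u x - k - ℓ (x - x₀) - (u y - k - ℓ (y - x₀)) = u x - ℓ x - (u y - ℓ y) := by
      rw [map_sub, map_sub]; ring
    rw [e1] at h1
    refine h1.trans (le_of_eq ?_)
    field_simp
  exact le_of_mul_le_mul_left h2 hA

theorem LipOnBall.rescale {n : ℕ} {u : Rn n → ℝ} {x₀ : Rn n} {r A c ρ : ℝ} (hr : 0 < r)
    (hA : 0 < A) (k : ℝ) (ℓ : Rn n →L[ℝ] ℝ) (h : LipOnBall u x₀ (r * ρ) c) :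
    LipOnBall (fun x => A * (u (x₀ + r • x) - k - ℓ (r • x))) 0 ρ (A * r * (c + ‖ℓ‖)) := by
  intro x hx y hy
  have hmem : ∀ x ∈ ball (0 : Rn n) ρ, x₀ + r • x ∈ ball x₀ (r * ρ) := by
    intro x hx
    rw [mem_ball_zero_iff] at hx
    rw [mem_ball, dist_eq_norm, add_sub_cancel_left, norm_smul, Real.norm_of_nonneg hr.le]
    gcongr
  have h1 := h _ (hmem x hx) _ (hmem y hy)
  rw [add_sub_add_left_eq_sub, ← smul_sub, norm_smul, Real.norm_of_nonneg hr.le] at h1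
  have h2 : |ℓ (r • x) - ℓ (r • y)| ≤ ‖ℓ‖ * (r * ‖x - y‖) := by
    rw [← map_sub, ← smul_sub]
    refine (ℓ.le_opNorm _).trans (le_of_eq ?_)
    rw [norm_smul, Real.norm_of_nonneg hr.le]
  have e1 : A * (u (x₀ + r • x) - k - ℓ (r • x)) - A * (u (x₀ + r • y) - k - ℓ (r • y)) =
      A * ((u (x₀ + r • x) - u (x₀ + r • y)) - (ℓ (r • x) - ℓ (r • y))) := by ring
  rw [e1, abs_mul, abs_of_pos hA]
  have h3 := (abs_sub (u (x₀ + r • x) - u (x₀ + r • y)) (ℓ (r • x) - ℓ (r • y))).trans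
    (add_le_add h1 h2)
  refine (mul_le_mul_of_nonneg_left h3 hA.le).trans (le_of_eq (by ring))

theorem rpow_le_mul_of_one_le {s p : ℝ} (hs : 1 ≤ s) (hp : p ≤ 1) : s ^ p ≤ s := by
  conv_rhs => rw [← Real.rpow_one s]
  exact Real.rpow_le_rpow_of_exponent_le hs hp

/-- Radii above `1 / 4` follow from the growth bound alone. Below that, the decay applies around `z`
with slope zero. The factor `R` carries the growth needed when a later rescaling starts at scale
`d`. -/
theorem ObstacleSolution.lipOnBall_of_zero {n : ℕ} {lam Lam ε β τ δ : ℝ}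
    (H : HolderDecay n lam Lam ε β τ δ) (hε : 0 < ε) (hε' : ε ≤ 1 / 2)
    (hτ' : τ ≤ 1 / 2) (hδ : 0 < δ) (hδ' : δ ≤ 1) {a : Rn n → ℝ} {b : Rn n} {K C : ℝ} (hK : 0 < K)
    (hC : 1 ≤ C) {u : Rn n → ℝ} (ha : IsEllipticKernel lam Lam a) (hb : ‖b‖ = β)
    (hu : ObstacleSolution a b ε K C u) {z : Rn n} (hz : ‖z‖ < 1) (huz : u z = 0) {d R : ℝ}
    (hd : 0 < d) (hd1 : d ≤ 1) (hR : 1 ≤ R) :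
    LipOnBall u z (d * R) (128 * C / δ * K * d ^ τ * R ^ (1 - ε)) := by
  have hC0 : 0 < C := by linarith
  have hgrow : ∀ ρ : ℝ, 1 / 4 < ρ → LipOnBall u z ρ (5 * C * K * ρ ^ (1 - ε)) := by
    intro ρ hρ
    refine (hu.growth (5 * ρ) (by linarith)).mono ?_ ?_
    · refine ball_subset_ball' ?_
      rw [dist_zero_right]; linarith
    · rw [Real.mul_rpow (by norm_num) (by linarith)]
      have h1 := rpow_le_mul_of_one_le (by norm_num : (1 : ℝ) ≤ 5) (by linarith : 1 - ε ≤ 1)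
      have h2 : C * K * ((5 : ℝ) ^ (1 - ε) * ρ ^ (1 - ε)) ≤ C * K * (5 * ρ ^ (1 - ε)) := by
        gcongr
      linarith
  have hRε : R ^ τ ≤ R ^ (1 - ε) := Real.rpow_le_rpow_of_exponent_le hR (by linarith)
  have hdτ : 0 < d ^ τ := Real.rpow_pos_of_pos hd _
  have hRε0 : 0 < R ^ (1 - ε) := Real.rpow_pos_of_pos (by linarith) _
  have hCδ : C ≤ C / δ := by rw [le_div_iff₀ hδ]; nlinarith
  rcases lt_or_ge (1 / 4) (d * R) with h | h
  · refine (hgrow _ h).mono Subset.rfl ?_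
    rw [Real.mul_rpow hd.le (by linarith)]
    have h1 : d ^ (1 - ε) ≤ d ^ τ := Real.rpow_le_rpow_of_exponent_ge hd hd1 (by linarith)
    have h2 : 5 * C * K * (d ^ (1 - ε) * R ^ (1 - ε)) ≤
        128 * (C / δ) * K * (d ^ τ * R ^ (1 - ε)) := by
      gcongr; norm_num
    refine h2.trans (le_of_eq (by ring))
  · have hA : 0 < δ / (C * K) := by positivity
    have hsol := AlmostConvexSolution.of_affine (x₀ := z) (r := 1 / 4) (A := δ / (C * K))
      (μ := δ) (U := ball 0 2) (0 : Rn n →L[ℝ] ℝ)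
      hu.lipschitz hu.semiconvex hu.subsolution (by norm_num) hA ?_ ?_ ?_ ?_
    · have hdec := H _ b _ (ha.comp_smul (by norm_num : (0 : ℝ) < 1 / 4)) hb hsol ?_
        (4 * (d * R)) (by positivity) (by linarith)
      · have h1 : (8 * (4 * (d * R))) ^ τ ≤ 32 * (d ^ τ * R ^ (1 - ε)) := by
          have e1 : 8 * (4 * (d * R)) = 32 * (d * R) := by ring
          rw [e1, Real.mul_rpow (by norm_num) (by positivity), Real.mul_rpow hd.le (by linarith)]
          have h2 := rpow_le_mul_of_one_le (by norm_num : (1 : ℝ) ≤ 32) (by linarith : τ ≤ 1)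
          gcongr
        have h3 : 32 * (d ^ τ * R ^ (1 - ε)) =
            δ / (C * K) * (1 / 4) * (128 * C / δ * K * d ^ τ * R ^ (1 - ε)) := by
          field_simp; norm_num
        have h4 := LipOnBall.of_rescale (by norm_num) hA
          (hdec.mono Subset.rfl (h1.trans (le_of_eq h3)))
        have e2 : 1 / 4 * (4 * (d * R)) = d * R := by ring
        rw [e2] at h4
        simpa using h4
      · intro S hS
        have h1 : LipOnBall u z (1 / 4 * S) (2 * (C * K * S ^ (1 - ε))) := by
          refine (hu.growth (2 * S) (by linarith)).mono ?_ ?_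
          · refine ball_subset_ball' ?_
            rw [dist_zero_right]; linarith
          · rw [Real.mul_rpow (by norm_num) (by linarith)]
            have h1 := rpow_le_mul_of_one_le (by norm_num : (1 : ℝ) ≤ 2) (by linarith : 1 - ε ≤ 1)
            have h2 : C * K * ((2 : ℝ) ^ (1 - ε) * S ^ (1 - ε)) ≤ C * K * (2 * S ^ (1 - ε)) := by
              gcongr
            linarith
        refine (h1.rescale (by norm_num) hA (u z) 0).mono Subset.rfl ?_
        have hS0 : 0 < S ^ (1 - ε) := Real.rpow_pos_of_pos (by linarith) _
        rw [norm_zero, add_zero]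
        have e1 : δ / (C * K) * (1 / 4) * (2 * (C * K * S ^ (1 - ε))) = δ * S ^ (1 - ε) / 2 := by
          field_simp; norm_num
        rw [e1]
        linarith [mul_pos hδ hS0]
    · have e1 : δ / (C * K) * (1 / 4) ^ 2 * K = δ * (1 / (16 * C)) := by field_simp; norm_num
      rw [e1]
      have : 1 / (16 * C) ≤ 1 := by rw [div_le_one (by positivity)]; linarith
      nlinarith
    · intro x hx
      rw [mem_ball_zero_iff] at hx ⊢
      have := norm_add_le z ((1 / 4 : ℝ) • x)
      rw [norm_smul] at this
      norm_num at this
      linarith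
    · intro x _
      rw [huz]
      simp only [sub_zero, zero_apply]
      have := hu.nonneg x
      positivity
    -- Nonnegativity at `x - h` turns a positive increment into `0 < u x`.
    · intro h x hx hlt
      refine ⟨lt_of_le_of_lt (hu.nonneg (x - h)) ?_, hx⟩
      simpa using hlt

/-- With `d` the distance to the zero set, the bound around the nearest zero controls `u`, and hence
its gradient at `x₀`, when `ρ ≥ d / 2`. For smaller `ρ` the decay applies at scale `d / 2`; its
factor `(ρ / d) ^ τ` times the slope `d ^ τ` at that scale is `ρ ^ τ`. -/
theorem ObstacleSolution.lipOnBall_sub_fderiv {n : ℕ} {lam Lam ε β τ δ : ℝ}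
    (H : HolderDecay n lam Lam ε β τ δ) (hε : 0 < ε) (hε' : ε ≤ 1 / 2)
    (hτ' : τ ≤ 1 / 2) (hδ : 0 < δ) (hδ' : δ ≤ 1) {a : Rn n → ℝ} {b : Rn n} {K C : ℝ} (hK : 0 < K)
    (hC : 1 ≤ C) {u : Rn n → ℝ} (ha : IsEllipticKernel lam Lam a) (hb : ‖b‖ = β)
    (hu : ObstacleSolution a b ε K C u) {x₀ : Rn n} (hx₀ : ‖x₀‖ < 1 / 2)
    (hdiff : DifferentiableAt ℝ u x₀) {ρ : ℝ} (hρ : 0 < ρ) (hρ1 : ρ ≤ 1) :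
    LipOnBall (fun x => u x - fderiv ℝ u x₀ x) x₀ ρ (64 * (128 * C / δ) / δ * K * ρ ^ τ) := by
  have hC0 : 0 < C := by linarith
  obtain ⟨C₁, hC₁⟩ : ∃ C₁, C₁ = 128 * C / δ := ⟨_, rfl⟩
  have hC₁1 : 1 ≤ C₁ := by rw [hC₁, le_div_iff₀ hδ]; linarith
  rw [← hC₁]
  obtain ⟨ℓ, hℓ⟩ : ∃ ℓ, ℓ = fderiv ℝ u x₀ := ⟨_, rfl⟩
  rw [← hℓ]
  obtain ⟨M, hM⟩ := hu.lipschitz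
  have hclosed : IsClosed {x | u x = 0} := isClosed_eq hM.continuous continuous_const
  have hne : ({x | u x = 0} : Set (Rn n)).Nonempty := ⟨0, hu.zero⟩
  obtain ⟨z, hz, hzd⟩ := hclosed.exists_infDist_eq_dist hne x₀
  obtain ⟨d, hd⟩ : ∃ d, d = dist x₀ z := ⟨_, rfl⟩
  have hd0 : 0 ≤ d := hd ▸ dist_nonneg
  have hdx₀ : d ≤ ‖x₀‖ := by
    rw [hd, ← hzd, ← dist_zero_right]
    exact infDist_le_dist_of_mem hu.zero
  have hz1 : ‖z‖ < 1 := by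
    have h1 : ‖z‖ ≤ ‖x₀‖ + ‖x₀ - z‖ := by simpa using norm_sub_le x₀ (x₀ - z)
    rw [← dist_eq_norm, ← hd] at h1
    linarith
  have hzlip : ∀ {s R : ℝ}, 0 < s → s ≤ 1 → 1 ≤ R →
      LipOnBall u z (s * R) (C₁ * K * s ^ τ * R ^ (1 - ε)) := fun hs hs1 hR => by
    rw [hC₁]
    exact hu.lipOnBall_of_zero H hε hε' hτ' hδ hδ' hK hC ha hb hz1 hz hs hs1 hR
  have hcδ : C₁ ≤ C₁ / δ := by rw [le_div_iff₀ hδ]; nlinarith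
  rcases le_or_gt (d / 2) ρ with hdρ | hdρ
  · have hρτ : 0 < ρ ^ τ := Real.rpow_pos_of_pos hρ _
    have h1 : LipOnBall u x₀ ρ (3 * (C₁ * K * ρ ^ τ)) := by
      refine (hzlip hρ hρ1 (by norm_num : (1 : ℝ) ≤ 3)).mono (ball_subset_ball' ?_) ?_
      · rw [← hd]; linarith
      · have := rpow_le_mul_of_one_le (by norm_num : (1 : ℝ) ≤ 3) (by linarith : 1 - ε ≤ 1)
        rw [mul_comm 3]
        gcongr
    have h2 : ‖ℓ‖ ≤ 3 * (C₁ * K * ρ ^ τ) := by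
      rw [hℓ]; exact h1.norm_fderiv_le (by positivity) (mem_ball_self hρ)
    intro x hx y hy
    have h3 := h1 x hx y hy
    have h4 : |ℓ x - ℓ y| ≤ ‖ℓ‖ * ‖x - y‖ := by rw [← map_sub]; exact ℓ.le_opNorm _
    have h5 : u x - ℓ x - (u y - ℓ y) = (u x - u y) - (ℓ x - ℓ y) := by ring
    rw [h5]
    have h6 : ‖ℓ‖ * ‖x - y‖ ≤ 3 * (C₁ * K * ρ ^ τ) * ‖x - y‖ :=
      mul_le_mul_of_nonneg_right h2 (norm_nonneg _)
    have h7 : 6 * C₁ * K * ρ ^ τ * ‖x - y‖ ≤ 64 * (C₁ / δ) * K * ρ ^ τ * ‖x - y‖ := by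
      gcongr; norm_num
    have h8 : 64 * C₁ / δ * K * ρ ^ τ * ‖x - y‖ = 64 * (C₁ / δ) * K * ρ ^ τ * ‖x - y‖ := by ring
    rw [h8]
    have h9 := abs_sub (u x - u y) (ℓ x - ℓ y)
    linarith
  · have hd' : 0 < d := by linarith
    have hd1 : d ≤ 1 := by linarith
    have hdτ : 0 < d ^ τ := Real.rpow_pos_of_pos hd' _
    have hlipd : ∀ R : ℝ, 1 ≤ R → LipOnBall u x₀ (d * R) (2 * (C₁ * K * d ^ τ * R ^ (1 - ε))) := by
      intro R hR
      refine (hzlip hd' hd1 (by linarith : 1 ≤ 2 * R)).mono (ball_subset_ball' ?_) ?_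
      · rw [← hd]; nlinarith
      · rw [Real.mul_rpow (by norm_num) (by linarith)]
        have h1 := rpow_le_mul_of_one_le (by norm_num : (1 : ℝ) ≤ 2) (by linarith : 1 - ε ≤ 1)
        have h2 : C₁ * K * d ^ τ * ((2 : ℝ) ^ (1 - ε) * R ^ (1 - ε)) ≤
            C₁ * K * d ^ τ * (2 * R ^ (1 - ε)) := by gcongr
        linarith
    have hℓn : ‖ℓ‖ ≤ 2 * (C₁ * K * d ^ τ) := by
      have h1 := hlipd 1 le_rfl
      rw [Real.one_rpow, mul_one, mul_one] at h1
      rw [hℓ]; exact h1.norm_fderiv_le (by positivity) (mem_ball_self hd')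
    -- Both `u` and `ℓ` have slope at most `2 * C₁ * K * d ^ τ * R ^ (1 - ε)`; this `A` turns their
    -- sum into `δ * R ^ (1 - ε)`.
    obtain ⟨A, hA⟩ : ∃ A, A = δ / (2 * C₁ * K * d * d ^ τ) := ⟨_, rfl⟩
    have hA0 : 0 < A := by rw [hA]; positivity
    have hd2 : 0 < d / 2 := by positivity
    have hU2 : ball x₀ d ⊆ ball (0 : Rn n) 2 := ball_subset_ball' (by
      rw [dist_zero_right]; linarith)
    have hUx : ∀ x ∈ ball (0 : Rn n) 2, x₀ + (d / 2) • x ∈ ball x₀ d := by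
      intro x hx
      rw [mem_ball_zero_iff] at hx
      rw [mem_ball, dist_eq_norm, add_sub_cancel_left, norm_smul, Real.norm_of_nonneg hd2.le]
      nlinarith
    have hpos : ∀ x ∈ ball x₀ d, 0 < u x := by
      intro x hx
      refine lt_of_le_of_ne (hu.nonneg x) fun h0 => ?_
      have h1 : infDist x₀ {x | u x = 0} ≤ dist x₀ x := infDist_le_dist_of_mem h0.symm
      rw [hzd, ← hd, dist_comm] at h1
      exact absurd (mem_ball.1 hx) (not_lt.2 h1)
    have hsol := AlmostConvexSolution.of_affine (x₀ := x₀) (r := d / 2) (A := A)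
      (μ := δ) (U := ball x₀ d) ℓ hu.lipschitz (ConvexOn.subset hu.semiconvex hU2 (convex_ball _ _))
      hu.subsolution hd2 hA0 ?_ hUx ?_ ?_
    · have hdec := H _ b _ (ha.comp_smul hd2) hb hsol ?_
        (ρ / (d / 2)) (by positivity) (by rw [div_le_one hd2]; exact hdρ.le)
      · have h1 : (8 * (ρ / (d / 2))) ^ τ ≤ 16 * (ρ ^ τ / d ^ τ) := by
          have e1 : 8 * (ρ / (d / 2)) = 16 * (ρ / d) := by field_simp; norm_num
          rw [e1, Real.mul_rpow (by norm_num) (by positivity), Real.div_rpow hρ.le hd0]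
          have h2 := rpow_le_mul_of_one_le (by norm_num : (1 : ℝ) ≤ 16) (by linarith : τ ≤ 1)
          gcongr
        have h3 : 16 * (ρ ^ τ / d ^ τ) = A * (d / 2) * (64 * C₁ / δ * K * ρ ^ τ) := by
          rw [hA]
          field_simp
          norm_num
        have h4 := LipOnBall.of_rescale hd2 hA0 (hdec.mono Subset.rfl (h1.trans (le_of_eq h3)))
        rwa [mul_div_cancel₀ _ hd2.ne'] at h4
      · intro R hR
        have hR1 : 1 ≤ R ^ (1 - ε) := Real.one_le_rpow hR (by linarith)
        have h1 : LipOnBall u x₀ (d / 2 * R) (2 * (C₁ * K * d ^ τ * R ^ (1 - ε))) :=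
          (hlipd R hR).mono (ball_subset_ball (by nlinarith)) le_rfl
        refine (h1.rescale hd2 hA0 (u x₀) ℓ).mono Subset.rfl ?_
        have h2 : C₁ * K * d ^ τ * 1 ≤ C₁ * K * d ^ τ * R ^ (1 - ε) := by gcongr
        have h3 : A * (d / 2) * (2 * (C₁ * K * d ^ τ * R ^ (1 - ε)) + ‖ℓ‖) ≤
            A * (d / 2) * (4 * (C₁ * K * d ^ τ * R ^ (1 - ε))) := by
          gcongr; linarith
        refine h3.trans (le_of_eq ?_)
        rw [hA]
        field_simp
        norm_num
    · have e1 : A * (d / 2) ^ 2 * K = δ * (d / d ^ τ * (1 / (8 * C₁))) := by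
        rw [hA]; field_simp; norm_num
      rw [e1]
      have h1 : d / d ^ τ ≤ 1 := by
        rw [div_le_one hdτ]
        conv_lhs => rw [← Real.rpow_one d]
        exact Real.rpow_le_rpow_of_exponent_ge hd' hd1 (by linarith)
      have h2 : 1 / (8 * C₁) ≤ 1 := by rw [div_le_one (by positivity)]; linarith
      have h3 : d / d ^ τ * (1 / (8 * C₁)) ≤ 1 := mul_le_one₀ h1 (by positivity) h2
      nlinarith
    · intro x hx
      rw [hℓ]
      exact hu.semiconvex.fderiv_le hK.le (by rw [mem_ball_zero_iff]; linarith) (hU2 hx) hdiff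
    · intro h x hx _
      exact ⟨hpos x hx, hU2 hx⟩

/-- Every point of the ball has a supporting slope, as a limit of gradients. -/
theorem ObstacleSolution.exists_lipOnBall_sub {n : ℕ} {lam Lam ε β τ δ : ℝ}
    (H : HolderDecay n lam Lam ε β τ δ) (hε : 0 < ε) (hε' : ε ≤ 1 / 2)
    (hτ' : τ ≤ 1 / 2) (hδ : 0 < δ) (hδ' : δ ≤ 1) {a : Rn n → ℝ} {b : Rn n} {K C : ℝ} (hK : 0 < K)
    (hC : 1 ≤ C) {u : Rn n → ℝ} (ha : IsEllipticKernel lam Lam a) (hb : ‖b‖ = β)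
    (hu : ObstacleSolution a b ε K C u) {x₀ : Rn n} (hx₀ : ‖x₀‖ < 1 / 2) :
    ∃ ℓ : Rn n →L[ℝ] ℝ, ∀ ρ : ℝ, 0 < ρ → ρ ≤ 1 →
      LipOnBall (fun x => u x - ℓ x) x₀ ρ (64 * (128 * C / δ) / δ * K * ρ ^ τ) := by
  obtain ⟨M, hM⟩ := hu.lipschitz
  have hcl : x₀ ∈ closure (ball (0 : Rn n) (1 / 2) ∩ {x | DifferentiableAt ℝ u x}) :=
    (Measure.dense_of_ae (hM.ae_differentiableAt (μ := volume))).open_subset_closure_inter isOpen_ball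
      (by rwa [mem_ball_zero_iff])
  obtain ⟨x, hx, hlim⟩ := mem_closure_iff_seq_limit.1 hcl
  obtain ⟨ℓ, -, φ, hφ, hℓ⟩ := tendsto_subseq_of_bounded
    (isBounded_closedBall (x := (0 : Rn n →L[ℝ] ℝ)) (r := M))
    (fun k => show fderiv ℝ u (x k) ∈ closedBall (0 : Rn n →L[ℝ] ℝ) M by
      rw [mem_closedBall_zero_iff]; exact norm_fderiv_le_of_lipschitz ℝ hM)
  refine ⟨ℓ, fun ρ hρ hρ1 p hp q hq => ?_⟩
  have hlimφ := hlim.comp hφ.tendsto_atTop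
  have hev : ∀ p ∈ ball x₀ ρ, ∀ᶠ k in atTop, p ∈ ball (x (φ k)) ρ := by
    intro p hp
    have h1 : Tendsto (fun k => dist p (x (φ k))) atTop (𝓝 (dist p x₀)) :=
      tendsto_const_nhds.dist hlimφ
    exact h1.eventually_lt_const (mem_ball.1 hp)
  have happ : ∀ p, Tendsto (fun k => fderiv ℝ u (x (φ k)) p) atTop (𝓝 (ℓ p)) := fun p =>
    ((ContinuousLinearMap.apply ℝ ℝ p).continuous.tendsto ℓ).comp hℓ
  have hlim2 : Tendsto (fun k => |u p - fderiv ℝ u (x (φ k)) p - (u q - fderiv ℝ u (x (φ k)) q)|)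
      atTop (𝓝 |u p - ℓ p - (u q - ℓ q)|) :=
    ((tendsto_const_nhds.sub (happ p)).sub (tendsto_const_nhds.sub (happ q))).abs
  refine le_of_tendsto hlim2 ?_
  filter_upwards [hev p hp, hev q hq] with k h1 h2
  exact hu.lipOnBall_sub_fderiv H hε hε' hτ' hδ hδ' hK hC ha hb
    (mem_ball_zero_iff.1 (hx (φ k)).1) (hx (φ k)).2 hρ hρ1 p h1 q h2

/-! ### From expansions to Hölder continuity of the gradient -/

theorem hasFDerivAt_of_lipOnBall_sub {n : ℕ} {u : Rn n → ℝ} {x₀ : Rn n} {ℓ : Rn n →L[ℝ] ℝ}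
    {c τ : ℝ} (hτ : 0 < τ)
    (h : ∀ ρ : ℝ, 0 < ρ → ρ ≤ 1 → LipOnBall (fun x => u x - ℓ x) x₀ ρ (c * ρ ^ τ)) :
    HasFDerivAt u ℓ x₀ := by
  rw [hasFDerivAt_iff_isLittleO, Asymptotics.isLittleO_iff]
  intro η hη
  have hlim : Tendsto (fun ρ : ℝ => c * ρ ^ τ) (𝓝[>] 0) (𝓝 0) := by
    have h1 : Tendsto (fun ρ : ℝ => c * ρ ^ τ) (𝓝 0) (𝓝 (c * 0 ^ τ)) :=
      ((Real.continuousAt_rpow_const 0 τ (Or.inr hτ.le)).tendsto).const_mul c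
    rw [Real.zero_rpow hτ.ne', mul_zero] at h1
    exact h1.mono_left nhdsWithin_le_nhds
  obtain ⟨ρ, hρ, hρI⟩ := ((hlim.eventually_lt_const hη).and
    (Ioc_mem_nhdsGT (zero_lt_one' ℝ))).exists
  filter_upwards [ball_mem_nhds x₀ hρI.1] with x hx
  have h1 := h ρ hρI.1 hρI.2 x hx x₀ (mem_ball_self hρI.1)
  have e1 : u x - u x₀ - ℓ (x - x₀) = u x - ℓ x - (u x₀ - ℓ x₀) := by rw [map_sub]; ring
  rw [e1, Real.norm_eq_abs]
  exact h1.trans (mul_le_mul_of_nonneg_right hρ.le (norm_nonneg _))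

/-- The derivative of `u - ℓ` at `y` is `ℓ' - ℓ`, so it is bounded by the Lipschitz constant of `u -
ℓ` in a ball around `x` containing `y`. Radius `2 * dist x y`, capped at `1`, suffices. -/
theorem norm_sub_le_of_lipOnBall_sub {n : ℕ} {u : Rn n → ℝ} {x y : Rn n} {ℓ ℓ' : Rn n →L[ℝ] ℝ}
    {c τ : ℝ} (hc : 0 ≤ c) (hτ : 0 < τ) (hτ' : τ ≤ 1)
    (h : ∀ ρ : ℝ, 0 < ρ → ρ ≤ 1 → LipOnBall (fun x => u x - ℓ x) x ρ (c * ρ ^ τ))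
    (hy : HasFDerivAt u ℓ' y) (hxy : dist x y < 1) :
    ‖ℓ' - ℓ‖ ≤ 2 * c * dist x y ^ τ := by
  rcases eq_or_ne x y with rfl | hne
  · rw [hy.unique (hasFDerivAt_of_lipOnBall_sub hτ h), sub_self, norm_zero]
    positivity
  have hd : 0 < dist x y := dist_pos.2 hne
  have hρ : dist x y < min (2 * dist x y) 1 := lt_min (by linarith) hxy
  have hρ0 := hd.trans hρ
  have h1 := h _ hρ0 (min_le_right _ _)
  have h2 := h1.norm_fderiv_le (by positivity) (x := y) (by rw [mem_ball']; exact hρ)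
  rw [(hy.fun_sub ℓ.hasFDerivAt).fderiv] at h2
  refine h2.trans ?_
  have h3 : min (2 * dist x y) 1 ^ τ ≤ 2 * dist x y ^ τ := by
    have h4 : min (2 * dist x y) 1 ^ τ ≤ (2 * dist x y) ^ τ :=
      Real.rpow_le_rpow hρ0.le (min_le_left _ _) hτ.le
    rw [Real.mul_rpow (by norm_num) hd.le] at h4
    refine h4.trans ?_
    gcongr
    exact rpow_le_mul_of_one_le (by norm_num) hτ'
  calc c * min (2 * dist x y) 1 ^ τ ≤ c * (2 * dist x y ^ τ) := by gcongr
    _ = _ := by ring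

theorem ObstacleSolution.contDiffOn_and_eC1HolderNorm_le {n : ℕ} {lam Lam ε β δ : ℝ} {τ : ℝ≥0}
    (H : HolderDecay n lam Lam ε β τ δ) (hε : 0 < ε) (hε' : ε ≤ 1 / 2) (hτ : (0 : ℝ) < τ)
    (hτ' : (τ : ℝ) ≤ 1 / 2) (hδ : 0 < δ) (hδ' : δ ≤ 1) {a : Rn n → ℝ} {b : Rn n} {K C : ℝ}
    (hK : 0 < K) (hC : 1 ≤ C) {u : Rn n → ℝ} (ha : IsEllipticKernel lam Lam a) (hb : ‖b‖ = β)
    (hu : ObstacleSolution a b ε K C u) :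
    ContDiffOn ℝ 1 u (ball 0 (1 / 2)) ∧ eC1HolderNorm τ (ball 0 (1 / 2)) u ≤
      ENNReal.ofReal ((2 * C + 2 * (64 * (128 * C / δ) / δ)) * K) := by
  have hC0 : 0 < C := by linarith
  obtain ⟨C₂, hC₂⟩ : ∃ C₂, C₂ = 64 * (128 * C / δ) / δ := ⟨_, rfl⟩
  have hC₂0 : 0 < C₂ := by rw [hC₂]; positivity
  rw [← hC₂]
  have hslope : ∀ x ∈ ball (0 : Rn n) (1 / 2), ∃ ℓ : Rn n →L[ℝ] ℝ, ∀ ρ : ℝ, 0 < ρ → ρ ≤ 1 →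
      LipOnBall (fun x => u x - ℓ x) x ρ (C₂ * K * ρ ^ (τ : ℝ)) := fun x hx => by
    rw [hC₂]
    exact hu.exists_lipOnBall_sub H hε hε' hτ' hδ hδ' hK hC ha hb (mem_ball_zero_iff.1 hx)
  have hderiv : ∀ x ∈ ball (0 : Rn n) (1 / 2), HasFDerivAt u (fderiv ℝ u x) x ∧
      ∀ ρ : ℝ, 0 < ρ → ρ ≤ 1 →
        LipOnBall (fun z => u z - fderiv ℝ u x z) x ρ (C₂ * K * ρ ^ (τ : ℝ)) := by
    intro x hx
    obtain ⟨ℓ, hℓ⟩ := hslope x hx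
    have h1 := hasFDerivAt_of_lipOnBall_sub hτ hℓ
    rw [h1.fderiv]
    exact ⟨h1, hℓ⟩
  have hhol : ∀ x ∈ ball (0 : Rn n) (1 / 2), ∀ y ∈ ball (0 : Rn n) (1 / 2),
      dist (fderiv ℝ u x) (fderiv ℝ u y) ≤ 2 * (C₂ * K) * dist x y ^ (τ : ℝ) := by
    intro x hx y hy
    rw [dist_comm (fderiv ℝ u x), dist_eq_norm]
    refine norm_sub_le_of_lipOnBall_sub (by positivity) hτ (by linarith) (hderiv x hx).2
      (hderiv y hy).1 ?_
    have := dist_triangle_right x y 0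
    rw [mem_ball] at hx hy
    linarith
  have hholder : HolderWith (Real.toNNReal (2 * C₂ * K)) τ
      ((ball (0 : Rn n) (1 / 2)).domRestrict (fderiv ℝ u)) := by
    intro x y
    rw [edist_dist, edist_dist, ENNReal.ofReal_rpow_of_nonneg dist_nonneg τ.coe_nonneg]
    change _ ≤ ENNReal.ofReal (2 * C₂ * K) * _
    rw [← ENNReal.ofReal_mul (by positivity)]
    refine ENNReal.ofReal_le_ofReal ((hhol x x.2 y y.2).trans (le_of_eq ?_))
    rw [← mul_assoc 2]; rfl
  have hlip : LipOnBall u 0 1 (C * K) := by simpa using hu.growth 1 le_rfl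
  refine ⟨?_, ?_⟩
  · have h1 := (contDiffOn_succ_iff_fderiv_of_isOpen (𝕜 := ℝ) (n := 0) (f := u)
      (isOpen_ball (x := (0 : Rn n)) (ε := 1 / 2))).2
    rw [zero_add] at h1
    refine h1 ⟨fun x hx => (hderiv x hx).1.differentiableAt.differentiableWithinAt, by simp, ?_⟩
    rw [contDiffOn_zero, continuousOn_iff_continuous_domRestrict]
    exact hholder.continuous (by exact_mod_cast hτ)
  · unfold eC1HolderNorm
    have e1 : (2 * C + 2 * C₂) * K = C * K + C * K + 2 * C₂ * K := by ring
    rw [e1, ENNReal.ofReal_add (by positivity) (by positivity),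
      ENNReal.ofReal_add (by positivity) (by positivity)]
    refine add_le_add (add_le_add (iSup₂_le fun x hx => ?_) (iSup₂_le fun x hx => ?_))
      hholder.eHolderNorm_le
    · rw [← ofReal_norm, Real.norm_eq_abs]
      refine ENNReal.ofReal_le_ofReal ?_
      rw [mem_ball_zero_iff] at hx
      have h1 := hlip x (by rw [mem_ball_zero_iff]; linarith) 0 (by simp)
      rw [hu.zero, sub_zero, sub_zero] at h1
      have h2 : C * K * ‖x‖ ≤ C * K * 1 := by gcongr; linarith
      linarith
    · rw [← ofReal_norm]
      refine ENNReal.ofReal_le_ofReal (hlip.norm_fderiv_le (by positivity) ?_)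
      rw [mem_ball_zero_iff] at hx ⊢
      linarith

theorem SemiconvexOn.mono {n : ℕ} {K K' : ℝ} {U : Set (Rn n)} {u : Rn n → ℝ}
    (hu : SemiconvexOn K U u) (hK : K ≤ K') : SemiconvexOn K' U u := by
  refine ⟨hu.1, fun x hx y hy s t hs ht hst => ?_⟩
  have h1 := hu.le_add hx hy hs ht hst
  have h2 := sq_norm_convex_combination x y hst
  have h3 : K * (s * t * ‖x - y‖ ^ 2) ≤ K' * (s * t * ‖x - y‖ ^ 2) := by gcongr
  simp only [smul_eq_mul]
  linear_combination h1 + h3 / 2 - K' / 2 * h2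

end Auxiliary

theorem proposition3p3 (n : ℕ) (hn : 1 ≤ n) (lam Lam : ℝ) (hlam : 0 < lam) (hLam : lam ≤ Lam)
    (ε : ℝ) (hε : 0 < ε) (β : ℝ) :
    ∃ τ : ℝ≥0, 0 < τ ∧ τ < 1 ∧ ∃ C : ℝ, 0 < C ∧
      ∀ (a : Rn n → ℝ) (b : Rn n) (K : ℝ) (u : Rn n → ℝ),
        IsEllipticKernel lam Lam a →
        ‖b‖ = β →
        (∃ M : ℝ≥0, LipschitzWith M u) →
        u 0 = 0 →
        (∀ x, 0 ≤ u x) →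
        SemiconvexOn K (Metric.ball 0 2) u →
        (∀ h : Rn n, ViscositySubsolution a b ({x | 0 < u x} ∩ Metric.ball 0 2) (K * ‖h‖)
          (fun x => u x - u (x - h))) →
        (∀ᵐ x : Rn n, ‖fderiv ℝ u x‖ ≤ K * (1 + ‖x‖ ^ (1 - ε))) →
        ContDiffOn ℝ 1 u (Metric.ball 0 (1 / 2)) ∧
          eC1HolderNorm τ (Metric.ball 0 (1 / 2)) u ≤ ENNReal.ofReal (C * K) := by
  -- Lowering `ε` to at most `1 / 2` only weakens the growth bound, and the iteration needs it.
  obtain ⟨τ, δ, hτ, hτ', hδ, hδ', H⟩ :=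
    exists_holder_decay hn hlam hLam (lt_min hε one_half_pos) (min_le_right ε (1 / 2)) β
  have hT : (0 : ℝ) < 4 ^ ε := Real.rpow_pos_of_pos (by norm_num) _
  obtain ⟨C₀, hC₀⟩ : ∃ C₀ : ℝ, C₀ = 4 + 2 * 4 ^ ε := ⟨_, rfl⟩
  have hC₀1 : 1 ≤ C₀ := by linarith
  have hC₀0 : 0 < C₀ := by linarith
  obtain ⟨C, hC⟩ : ∃ C : ℝ, C = 2 * C₀ + 2 * (64 * (128 * C₀ / δ) / δ) := ⟨_, rfl⟩
  have hC0 : 0 < C := by rw [hC]; positivity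
  lift τ to ℝ≥0 using hτ.le
  refine ⟨τ, by exact_mod_cast hτ, ?_, C, hC0, ?_⟩
  · rw [← NNReal.coe_lt_coe]
    push_cast
    linarith
  intro a b K u ha hb hu hu0 hnonneg hsc hsub hgrad
  have hK : 0 ≤ K := by
    obtain ⟨x, hx⟩ := hgrad.exists
    have h1 : 0 ≤ ‖x‖ ^ (1 - ε) := Real.rpow_nonneg (norm_nonneg _) _
    exact nonneg_of_mul_nonneg_left ((norm_nonneg _).trans hx) (by linarith)
  -- The normalization divides by the constant and `K` may vanish, so the estimate is proved for
  -- every `K' > K` before letting `K'` decrease to `K`.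
  have key : ∀ K' : ℝ, K < K' → ContDiffOn ℝ 1 u (Metric.ball 0 (1 / 2)) ∧
      eC1HolderNorm τ (Metric.ball 0 (1 / 2)) u ≤ ENNReal.ofReal (C * K') := by
    intro K' hK'
    have hK'0 : 0 < K' := hK.trans_lt hK'
    have hsc' := hsc.mono hK'.le
    have hsol : ObstacleSolution a b (min ε (1 / 2)) K' C₀ u :=
      { lipschitz := hu
        zero := hu0
        nonneg := hnonneg
        semiconvex := hsc'
        subsolution := fun h => (hsub h).mono subset_rfl
          (mul_le_mul_of_nonneg_right hK'.le (norm_nonneg h))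
        growth := fun R hR => by
          rw [hC₀]
          refine lipOnBall_of_gradient_growth hε.le (min_le_left ε (1 / 2))
            ((min_le_right ε (1 / 2)).trans (by norm_num)) hK'0.le hu hsc' ?_
            (lt_min hε one_half_pos).le hR
          filter_upwards [hgrad] with x hx
          exact hx.trans (mul_le_mul_of_nonneg_right hK'.le
            (add_nonneg zero_le_one (Real.rpow_nonneg (norm_nonneg _) _))) }
    rw [hC]
    exact hsol.contDiffOn_and_eC1HolderNorm_le H (lt_min hε one_half_pos)
      (min_le_right ε (1 / 2)) hτ hτ' hδ hδ' hK'0 hC₀1 ha hb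
  refine ⟨(key (K + 1) (by linarith)).1, ?_⟩
  have hlim : Filter.Tendsto (fun K' : ℝ => ENNReal.ofReal (C * K')) (nhdsWithin K (Set.Ioi K))
      (nhds (ENNReal.ofReal (C * K))) :=
    ((ENNReal.continuous_ofReal.comp (continuous_const.mul continuous_id)).tendsto K).mono_left
      nhdsWithin_le_nhds
  refine ge_of_tendsto hlim ?_
  filter_upwards [self_mem_nhdsWithin] with K' hK' using (key K' hK').2
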